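/- Fix integers $q\ge 2$, $r\ge 1$ and a finite abelian group $\mathcal Q$ of order $q$ (the alphabet). A vector $x\in\mathcal Q^{r,n}$ consists of $n$ blocks of length $r$. For $1\le j\le r$ let $e_j$ be the number of blocks of $x$ whose rightmost nonzero entry is in position $j$; the ordered weight of $x$ is $\mathrm w(x)=\sum_{j=1}^r j e_j$, and $d_r(x,y)=\mathrm w(x-y)$. An $(nr,M,d)$ ordered code is a set of $M\ge 1$ vectors of $\mathcal Q^{r,n}$ with $d_r(x,y)\ge d$ for any two distinct $x,y$ in the set. A set of coordinates is left-adjusted if with each coordinate it contains all the earlier coordinates of the same block. An ordered orthogonal array (OOA) of strength $t\le nr$ is a nonempty set $A\subset\mathcal Q^{r,n}$ whose projection on any left-adjusted set of $t$ coordinates contains each of the $q^t$ rows the same number of times. A code family of relative distance $\delta$ and rate $R$ is a sequence of $(rn_i,M_i,d_i)$ ordered codes ($r$ and $\mathcal Q$ fixed) with $n_i\to\infty$, $d_i/(rn_i)\to\delta$ and $\log_q M_i/(rn_i)\to R$. A family of OOAs of relative strength $\delta$ and rate $R$ is a sequence of OOAs $A_i\subset\mathcal Q^{r,n_i}$ of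 strength $t_i$ with $n_i\to\infty$, $t_i/(rn_i)\to\delta$ and $\log_q|A_i|/(rn_i)\to R$. Let $\delta_{\rm crit}=1-\frac1r\sum_{i=1}^r q^{-i}$, let $h_q(x)=-x\log_q\frac{x}{q-1}-(1-x)\log_q(1-x)$ (with $0\log_q 0=0$), let $L_i=\frac{q^{r-i+1}-1}{q^r(q-1)}$, and for $\tau_1,\dots,\tau_r\ge 0$ with $\tau=\sum_{i=1}^r\tau_i\le 1$ let $$\Lambda(\tau_1,\dots,\tau_r)=\sum_{i=1}^r L_i\Big(2\sqrt{(1-\tau)\tau_i(q-1)q^{i-1}}+(q-2)\tau_i q^{i-1}+2\,\frac{q-1}{q}\sum_{k=1}^{i-1}\sqrt{\tau_k\tau_i q^{i+k}}\Big).$$ Let the function $R_{\rm LP}(\delta)$ be given parametrically by $$R(\tau)=\frac1r\Big(h_q(\tau)+\tau\log_q\frac{q^r-1}{q-1}\Big),\qquad \delta(\tau)=\delta_{\rm crit}-\frac1r\max_{\substack{\tau_i\ge 0\\ \tau_1+\dots+\tau_r=\tau}}\Lambda(\tau_1,\dots,\tau_r),\qquad 0\le\tau\le 1,$$ that is, for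 $\delta$ in the range of $\delta(\tau)$, $R_{\rm LP}(\delta)=\inf\{R(\tau):0\le\tau\le 1,\ \delta(\tau)=\delta\}$. Theorem. For every $\delta$ in the range of $\delta(\tau)$, $0\le\tau\le1$: the rate of any code family of relative distance $\delta$ satisfies $R\le R_{\rm LP}(\delta)$, and the rate of any family of OOAs of relative strength $\delta$ satisfies $R\ge 1-R_{\rm LP}(\delta)$. -/

import Mathlib

namespace NRT

/-- Weight of one block `(b_1, ..., b_r)`: the position (counted from `1`) of its rightmost
nonzero entry, and `0` for the zero block. -/
noncomputable def blockWeight {Q : Type*} [AddCommGroup Q] {r : ℕ} (b : Fin r → Q) : ℕ :=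
  open Classical in
  (Finset.univ.filter (fun j : Fin r => b j ≠ 0)).sup (fun j => (j : ℕ) + 1)

/-- The shape `(e_1, ..., e_r)` of `x`: `e_j` is the number of blocks of `x` whose rightmost
nonzero entry is in position `j`. The index `j : Fin r` stands for position `j + 1`. -/
noncomputable def shape {Q : Type*} [AddCommGroup Q] {n r : ℕ} (x : Fin n → Fin r → Q)
    (j : Fin r) : ℕ :=
  (Finset.univ.filter (fun i : Fin n => blockWeight (x i) = (j : ℕ) + 1)).card

/-- The ordered weight `∑ j * e_j`. -/
noncomputable def weight {Q : Type*} [AddCommGroup Q] {n r : ℕ} (x : Fin n → Fin r → Q) : ℕ :=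
  ∑ j : Fin r, ((j : ℕ) + 1) * shape x j

/-- The ordered (Niederreiter-Rosenbloom-Tsfasman) distance. -/
noncomputable def ordDist {Q : Type*} [AddCommGroup Q] {n r : ℕ} (x y : Fin n → Fin r → Q) : ℕ :=
  weight (x - y)

/-- `C` is an `(nr, M, d)` ordered code with `M = C.card`. -/
def IsOrderedCode {Q : Type*} [AddCommGroup Q] {n r : ℕ} (d : ℕ)
    (C : Finset (Fin n → Fin r → Q)) : Prop :=
  C.Nonempty ∧ ∀ x ∈ C, ∀ y ∈ C, x ≠ y → d ≤ ordDist x y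

/-- A set of coordinates (block, position) is left-adjusted if with each coordinate it contains
all the earlier coordinates of the same block. -/
def LeftAdjusted {n r : ℕ} (I : Finset (Fin n × Fin r)) : Prop :=
  ∀ (i : Fin n) (j k : Fin r), (i, j) ∈ I → k ≤ j → (i, k) ∈ I

/-- `A` is an ordered orthogonal array of strength `t`: in its projection on any left-adjusted
set of `t` coordinates, each of the `q ^ t` rows occurs the same number `θ` of times. -/
def IsOOA {Q : Type*} {n r : ℕ} (t : ℕ) (A : Finset (Fin n → Fin r → Q)) : Prop :=
  open Classical in
  A.Nonempty ∧ t ≤ n * r ∧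
    ∃ θ : ℕ, ∀ I : Finset (Fin n × Fin r), LeftAdjusted I → I.card = t →
      ∀ c : {p : Fin n × Fin r // p ∈ I} → Q,
        (A.filter (fun x => ∀ p : {p : Fin n × Fin r // p ∈ I},
          x p.1.1 p.1.2 = c p)).card = θ

/-- There is a sequence of `(r n_i, M_i, d_i)` ordered codes over `Q`, with `r` fixed and
`n_i → ∞`, of relative distance `lim d_i / (r n_i) = δ` and of
rate `lim log_q M_i / (r n_i) = R`. -/
def IsCodeFamily (Q : Type*) [AddCommGroup Q] [Fintype Q] (r : ℕ) (δ R : ℝ) : Prop :=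
  ∃ (n d : ℕ → ℕ) (C : (i : ℕ) → Finset (Fin (n i) → Fin r → Q)),
    Filter.Tendsto n Filter.atTop Filter.atTop ∧
    (∀ i, IsOrderedCode (d i) (C i)) ∧
    Filter.Tendsto (fun i => (d i : ℝ) / ((r : ℝ) * (n i : ℝ))) Filter.atTop (nhds δ) ∧
    Filter.Tendsto
      (fun i => Real.logb (Fintype.card Q : ℝ) ((C i).card : ℝ) / ((r : ℝ) * (n i : ℝ)))
      Filter.atTop (nhds R)

/-- There is a sequence of ordered orthogonal arrays `A_i` of strength `t_i` in the space of `n_i`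
blocks of length `r` over `Q`, with `r` fixed and `n_i → ∞`, of relative
strength `lim t_i / (r n_i) = δ` and of rate `lim log_q |A_i| / (r n_i) = R`. -/
def IsOOAFamily (Q : Type*) [Fintype Q] (r : ℕ) (δ R : ℝ) : Prop :=
  ∃ (n t : ℕ → ℕ) (A : (i : ℕ) → Finset (Fin (n i) → Fin r → Q)),
    Filter.Tendsto n Filter.atTop Filter.atTop ∧
    (∀ i, IsOOA (t i) (A i)) ∧
    Filter.Tendsto (fun i => (t i : ℝ) / ((r : ℝ) * (n i : ℝ))) Filter.atTop (nhds δ) ∧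
    Filter.Tendsto
      (fun i => Real.logb (Fintype.card Q : ℝ) ((A i).card : ℝ) / ((r : ℝ) * (n i : ℝ)))
      Filter.atTop (nhds R)

/-- The `q`-ary entropy function, with logarithms to the base `q`
(at `x = 0` and `x = 1` the convention `0 * log 0 = 0` is in force). -/
noncomputable def qEntropy (q : ℕ) (x : ℝ) : ℝ :=
  -x * Real.logb q (x / ((q : ℝ) - 1)) - (1 - x) * Real.logb q (1 - x)

/-- `δ_crit = 1 - (1/r) ∑_{i=1}^r q^{-i}`. -/
noncomputable def deltaCrit (q r : ℕ) : ℝ :=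
  1 - 1 / (r : ℝ) * ∑ i ∈ Finset.Icc 1 r, ((q : ℝ) ^ i)⁻¹

/-- `L_i = (q^{r-i+1} - 1) / (q^r (q - 1))` for `1 ≤ i ≤ r`; the index `i : Fin r` stands
for `i + 1`. -/
noncomputable def coeffL (q r : ℕ) (i : Fin r) : ℝ :=
  ((q : ℝ) ^ (r - (i : ℕ)) - 1) / ((q : ℝ) ^ r * ((q : ℝ) - 1))

/-- The function `Λ(τ_1, ..., τ_r)`; the index `i : Fin r` stands for `i + 1`, so
that `q^{i-1}` is written `q ^ i`. -/
noncomputable def Lam (q r : ℕ) (t : Fin r → ℝ) : ℝ :=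
  ∑ i : Fin r, coeffL q r i *
    (2 * Real.sqrt ((1 - ∑ j, t j) * t i * ((q : ℝ) - 1) * (q : ℝ) ^ (i : ℕ))
      + ((q : ℝ) - 2) * t i * (q : ℝ) ^ (i : ℕ)
      + 2 * (((q : ℝ) - 1) / (q : ℝ)) *
        ∑ k ∈ Finset.univ.filter (fun k : Fin r => k < i),
          Real.sqrt (t k * t i * (q : ℝ) ^ (((i : ℕ) + 1) + ((k : ℕ) + 1))))

/-- The domain `τ_i ≥ 0`, `∑ τ_i = τ` of the maximization. -/
def tauSimplex (r : ℕ) (τ : ℝ) : Set (Fin r → ℝ) :=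
  {t | (∀ i, 0 ≤ t i) ∧ ∑ i, t i = τ}

/-- The maximum of `Λ` over `τ_i ≥ 0`, `∑ τ_i = τ`; it is attained, see `isGreatest_maxLam`. -/
noncomputable def maxLam (q r : ℕ) (τ : ℝ) : ℝ :=
  sSup (Lam q r '' tauSimplex r τ)

theorem isGreatest_maxLam (q r : ℕ) (hr : 1 ≤ r) (τ : ℝ) (hτ : 0 ≤ τ) :
    IsGreatest (Lam q r '' tauSimplex r τ) (maxLam q r τ) := by
  have hcl : IsClosed (tauSimplex r τ) := by
    have h1 : IsClosed {t : Fin r → ℝ | ∀ i, 0 ≤ t i} := by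
      simp only [Set.ofPred_forall]
      exact isClosed_iInter fun i => isClosed_le continuous_const (continuous_apply i)
    have h2 : IsClosed {t : Fin r → ℝ | ∑ i, t i = τ} :=
      isClosed_eq (by fun_prop) continuous_const
    exact h1.inter h2
  have hcomp : IsCompact (tauSimplex r τ) := by
    refine (isCompact_Icc (a := (0 : Fin r → ℝ)) (b := fun _ => τ)).of_isClosed_subset hcl ?_
    rintro t ⟨h0, hs⟩
    refine ⟨fun i => h0 i, fun i => ?_⟩
    rw [← hs]
    exact Finset.single_le_sum (f := t) (fun j _ => h0 j) (Finset.mem_univ i)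
  have hne : (tauSimplex r τ).Nonempty := by
    refine ⟨Pi.single (⟨0, hr⟩ : Fin r) τ, fun i => ?_, ?_⟩
    · by_cases h : i = ⟨0, hr⟩
      · subst h; simpa using hτ
      · simp [Pi.single_eq_of_ne h]
    · simp
  have hcont : Continuous (Lam q r) := by
    unfold Lam
    fun_prop
  exact (hcomp.image hcont).isGreatest_sSup (hne.image _)

/-- `R(τ) = (1/r) (h_q(τ) + τ log_q((q^r - 1)/(q - 1)))`. -/
noncomputable def lpRate (q r : ℕ) (τ : ℝ) : ℝ :=
  1 / (r : ℝ) * (qEntropy q τ + τ * Real.logb q (((q : ℝ) ^ r - 1) / ((q : ℝ) - 1)))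

/-- `δ(τ) = δ_crit - (1/r) max Λ`. -/
noncomputable def lpDelta (q r : ℕ) (τ : ℝ) : ℝ :=
  deltaCrit q r - 1 / (r : ℝ) * maxLam q r τ

/-- The function `R_LP(δ)` given parametrically by `δ = δ(τ)`, `R_LP = R(τ)`, `0 ≤ τ ≤ 1`,
for `δ` in the range of `δ(τ)`. If several parameters `τ` give the same `δ`, the
infimum of the values `R(τ)` is taken, so that a bound by `R_LP(δ)` is a bound by each of them. -/
noncomputable def RLP (q r : ℕ) (δ : ℝ) : ℝ :=
  sInf (lpRate q r '' {τ | τ ∈ Set.Icc (0 : ℝ) 1 ∧ lpDelta q r τ = δ})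

end NRT

/-!
The bounds come from a spectral form of Delsarte's linear programming method.

Let `X` and `H` be the groups of words of `n` blocks of length `r` over two dual alphabets. The
function `n r - weight` on `X` is the Fourier transform of a nonnegative kernel on `H` that changes
one block at a time, because `r - blockWeight` is a sum of indicator functions of subgroups
(`NRT.sum_blockKernel_mul`). If `f ≥ 0` on `H` satisfies `lam * f ≤ T f` for the convolution `T` by
this kernel, and `θ ≤ lam`, then `(n r - weight - θ) |f̂|²` has nonnegative Fourier coefficients and
is nonpositive where the weight is at least `n r - θ`. Delsarte's inequality for codes, with the
code in `X`, or for designs, with the array in `H`, then bounds the size in terms of the ratio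
`(∑ f)² / ∑ f²`, which is at most the size of the support of `f`
(`NRT.DualPairing.code_spectral_bound`, `NRT.DualPairing.design_spectral_bound`). The dual distance
of an array of strength `t` is at least `t + 1` (`NRT.IsOOA.sum_eq_zero`).

The function `f` is a Perron eigenvector of `T` restricted to the words with about `τ n` nonzero
blocks; their number is `exp (n * qaryEntropy (q ^ r) τ)` up to a subexponential factor, which is
the rate `R(τ)`. Its eigenvalue is bounded below by the Rayleigh quotient of a truncated product
function `∏ φ (h i)`, where `φ` is a unit vector on blocks with `φ 0 ^ 2 = 1 - τ`: the number of
nonzero blocks concentrates at `τ n` under the squares of this function, so the truncation costs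
little and the quotient is about `n` times the quadratic form of `φ`
(`NRT.exists_spectral_function`). If `φ` is constant on weight classes with masses `τ_1, ..., τ_r`,
that form is at least `r (1 - δ_crit) + Λ(τ_1, ..., τ_r)` (`NRT.exists_blockForm_ge_Lam`).

The spectral bounds need an eigenvalue strictly above the threshold `θ`, and the maximizer of `Λ`
only gives equality in the limit. The quadratic form is concave in the squares of `φ` and has its
maximum only at the constant function, so moving `φ` slightly towards the constant gains the
required gap, and the rate function is continuous (`NRT.le_lpRate_of_bound`). When `φ` is the
constant function itself, `τ = 1 - q ^ (-r)` and `R(τ) = 1`, and there is nothing to prove.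
-/

namespace NRT

open Finset ComplexConjugate

/-! ### Dual pairings and Delsarte's inequalities -/

/-- A duality between two finite abelian groups `X` and `H`: a bicharacter `X × H → ℂ` that
satisfies the orthogonality relations on both sides, so that `X` and `H` are in effect the
character groups of each other. Keeping both groups explicit makes the situation symmetric. -/
structure DualPairing (X H : Type*) [AddCommGroup X] [Fintype X] [AddCommGroup H]
    [Fintype H] where
  /-- The underlying bicharacter. -/
  toFun : X → H → ℂ
  zero_left : ∀ h, toFun 0 h = 1
  zero_right : ∀ x, toFun x 0 = 1
  add_left : ∀ x y h, toFun (x + y) h = toFun x h * toFun y h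
  add_right : ∀ x g h, toFun x (g + h) = toFun x g * toFun x h
  conj_left : ∀ x h, conj (toFun x h) = toFun (-x) h
  conj_right : ∀ x h, conj (toFun x h) = toFun x (-h)
  sum_right : ∀ x, x ≠ 0 → ∑ h, toFun x h = 0
  sum_left : ∀ h, h ≠ 0 → ∑ x, toFun x h = 0

namespace DualPairing

section

variable {X H : Type*} [AddCommGroup X] [Fintype X] [AddCommGroup H] [Fintype H]

/-- The pairing with the roles of the two groups exchanged. -/
def flip (E : DualPairing X H) : DualPairing H X where
  toFun h x := E.toFun x h
  zero_left := E.zero_right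
  zero_right := E.zero_left
  add_left x y h := E.add_right h x y
  add_right x g h := E.add_left g h x
  conj_left x h := E.conj_right h x
  conj_right x h := E.conj_left h x
  sum_right := E.sum_left
  sum_left := E.sum_right

/-- The canonical pairing of a finite abelian group with its group of characters. -/
def ofAddChar (Q : Type*) [AddCommGroup Q] [Fintype Q] [Fintype (AddChar Q ℂ)] :
    DualPairing Q (AddChar Q ℂ) where
  toFun x χ := χ x
  zero_left χ := χ.map_zero_eq_one
  zero_right x := AddChar.zero_apply x
  add_left x y χ := χ.map_add_eq_mul x y
  add_right x χ ψ := AddChar.add_apply χ ψ x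
  conj_left x χ := (AddChar.map_neg_eq_conj χ x).symm
  conj_right x χ := by rw [AddChar.neg_apply, AddChar.map_neg_eq_conj]
  sum_right x hx := by
    have h := AddChar.sum_apply_eq_zero_iff_ne_zero.2 hx
    convert h
  sum_left χ hχ := AddChar.sum_eq_zero_iff_ne_zero.2 hχ

/-- The coordinatewise product of a pairing. -/
def pi (E : DualPairing X H) (ι : Type*) [Fintype ι] [DecidableEq ι] :
    DualPairing (ι → X) (ι → H) where
  toFun x h := ∏ i, E.toFun (x i) (h i)
  zero_left h := by simp [E.zero_left]
  zero_right x := by simp [E.zero_right]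
  add_left x y h := by simp [E.add_left, prod_mul_distrib]
  add_right x y h := by simp [E.add_right, prod_mul_distrib]
  conj_left x h := by simp [map_prod, E.conj_left]
  conj_right x h := by simp [map_prod, E.conj_right]
  sum_right x hx := by
    obtain ⟨i, hi⟩ := Function.ne_iff.1 hx
    rw [← Fintype.prod_sum]
    exact prod_eq_zero (mem_univ i) (E.sum_right _ hi)
  sum_left h hh := by
    obtain ⟨i, hi⟩ := Function.ne_iff.1 hh
    rw [← Fintype.prod_sum (fun i x => E.toFun x (h i))]
    exact prod_eq_zero (mem_univ i) (E.sum_left _ hi)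

/-- The pairing of words `x` and `h` of length `r` in which position `l` of `x` is matched with
position `r + 1 - l` of `h`. With this convention both groups carry the same ordered weight. -/
def rev (E : DualPairing X H) (r : ℕ) : DualPairing (Fin r → X) (Fin r → H) where
  toFun x h := (E.pi (Fin r)).toFun x (fun l => h l.rev)
  zero_left h := (E.pi (Fin r)).zero_left _
  zero_right x := (E.pi (Fin r)).zero_right _
  add_left x y h := (E.pi (Fin r)).add_left _ _ _
  add_right x y h := (E.pi (Fin r)).add_right _ _ _
  conj_left x h := (E.pi (Fin r)).conj_left _ _
  conj_right x h := (E.pi (Fin r)).conj_right _ _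
  sum_right x hx := by
    rw [← (E.pi (Fin r)).sum_right x hx]
    exact Fintype.sum_equiv (Equiv.arrowCongr Fin.revPerm (Equiv.refl H)) _ _ fun h => rfl
  sum_left h hh := by
    refine (E.pi (Fin r)).sum_left _ fun h0 => hh ?_
    funext l
    simpa using congrFun h0 l.rev

lemma sub_left (E : DualPairing X H) (x y : X) (h : H) :
    E.toFun (x - y) h = E.toFun x h * conj (E.toFun y h) := by
  rw [sub_eq_add_neg, E.add_left, E.conj_left]

/-- The sum of a character over all differences of a set is a nonnegative real number. -/
lemma sum_sub_left (E : DualPairing X H) (C : Finset X) (h : H) :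
    ∑ x ∈ C, ∑ y ∈ C, E.toFun (x - y) h = ((‖∑ x ∈ C, E.toFun x h‖ ^ 2 : ℝ) : ℂ) := by
  simp_rw [E.sub_left, ← mul_sum, ← sum_mul, ← map_sum, Complex.mul_conj']
  push_cast
  rfl

/-- Delsarte's inequality for codes: a function on `X` with nonnegative Fourier coefficients `c`
that is nonpositive on all nonzero differences of `C` bounds the size of `C`. -/
theorem card_le_of_nonpos (E : DualPairing X H) {F : X → ℝ} {c : H → ℝ} (hc : ∀ h, 0 ≤ c h)
    (hF : ∀ x, (F x : ℂ) = ∑ h, (c h : ℂ) * E.toFun x h) (C : Finset X) (hC : C.Nonempty)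
    (hneg : ∀ x ∈ C, ∀ y ∈ C, x ≠ y → F (x - y) ≤ 0) : c 0 * (C.card : ℝ) ≤ F 0 := by
  classical
  have h1 : ∑ x ∈ C, ∑ y ∈ C, F (x - y) ≤ C.card * F 0 := by
    rw [← nsmul_eq_mul]
    refine sum_le_card_nsmul _ _ _ fun x hx => ?_
    rw [← add_sum_erase _ _ hx, sub_self]
    have : ∑ y ∈ C.erase x, F (x - y) ≤ 0 := sum_nonpos fun y hy =>
      hneg x hx y (mem_of_mem_erase hy) (ne_of_mem_erase hy).symm
    linarith
  have h2 : ∑ x ∈ C, ∑ y ∈ C, F (x - y) = ∑ h, c h * ‖∑ x ∈ C, E.toFun x h‖ ^ 2 := by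
    apply Complex.ofReal_injective
    push_cast
    simp_rw [hF]
    have : ∀ h, ((‖∑ x ∈ C, E.toFun x h‖ : ℂ)) ^ 2 = ∑ x ∈ C, ∑ y ∈ C, E.toFun (x - y) h :=
      fun h => by rw [sum_sub_left]; push_cast; rfl
    simp_rw [this, mul_sum]
    conv_rhs => rw [sum_comm]
    exact sum_congr rfl fun x _ => sum_comm
  have h3 : c 0 * (C.card : ℝ) ^ 2 ≤ ∑ h, c h * ‖∑ x ∈ C, E.toFun x h‖ ^ 2 := by
    refine le_trans (le_of_eq ?_) (single_le_sum (f := fun h => c h * ‖∑ x ∈ C, E.toFun x h‖ ^ 2)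
      (fun h _ => mul_nonneg (hc h) (sq_nonneg _)) (mem_univ 0))
    simp [E.zero_right]
  have hpos : (0 : ℝ) < C.card := by exact_mod_cast hC.card_pos
  nlinarith

/-- Delsarte's inequality for designs: if at each nonzero `x` the function is nonpositive or the
character sum of `A` vanishes, then `A` is large. -/
theorem le_card_of_nonpos (E : DualPairing X H) {F : X → ℝ} {c : H → ℝ} (hc : ∀ h, 0 ≤ c h)
    (hF : ∀ x, (F x : ℂ) = ∑ h, (c h : ℂ) * E.toFun x h) (A : Finset H) (hA : A.Nonempty)
    (hneg : ∀ x, x ≠ 0 → F x ≤ 0 ∨ ∑ a ∈ A, E.toFun x a = 0) :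
    c 0 * (Fintype.card X : ℝ) ≤ F 0 * A.card := by
  classical
  have h1 : ∑ x, F x * ‖∑ a ∈ A, E.toFun x a‖ ^ 2 ≤ F 0 * (A.card : ℝ) ^ 2 := by
    rw [← add_sum_erase _ _ (mem_univ (0 : X))]
    have : ∑ x ∈ univ.erase (0 : X), F x * ‖∑ a ∈ A, E.toFun x a‖ ^ 2 ≤ 0 :=
      sum_nonpos fun x hx => by
        rcases hneg x (ne_of_mem_erase hx) with h | h
        · exact mul_nonpos_of_nonpos_of_nonneg h (sq_nonneg _)
        · simp [h]
    simp only [E.zero_left, sum_const, nsmul_eq_mul, mul_one, Complex.norm_natCast]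
    linarith
  have h2 : ∑ x, F x * ‖∑ a ∈ A, E.toFun x a‖ ^ 2
      = Fintype.card X * ∑ a ∈ A, ∑ b ∈ A, c (b - a) := by
    apply Complex.ofReal_injective
    push_cast
    have h4 : ∀ x, ((‖∑ a ∈ A, E.toFun x a‖ : ℂ)) ^ 2 = ∑ a ∈ A, ∑ b ∈ A, E.toFun x (a - b) :=
      fun x => by
        have := E.flip.sum_sub_left A x
        simp only [flip] at this
        rw [this]; push_cast; rfl
    simp_rw [h4, hF, mul_sum, sum_mul]
    rw [sum_comm]
    refine sum_congr rfl fun a _ => ?_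
    rw [sum_comm]
    refine sum_congr rfl fun b _ => ?_
    rw [sum_comm]
    simp_rw [mul_assoc, ← E.add_right, ← mul_sum]
    rw [sum_eq_single (b - a)]
    · simp [E.zero_right, mul_comm]
    · intro h _ hh
      rw [E.sum_left _ (fun h0 => hh ?_), mul_zero]
      rw [eq_sub_iff_add_eq, ← sub_eq_zero, ← h0]; abel
    · simp
  have h3 : A.card * c 0 ≤ ∑ a ∈ A, ∑ b ∈ A, c (b - a) := by
    rw [← nsmul_eq_mul]
    refine card_nsmul_le_sum _ _ _ fun a ha => ?_
    have := single_le_sum (f := fun b => c (b - a)) (fun b _ => hc _) ha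
    simpa using this
  have hpos : (0 : ℝ) < A.card := by exact_mod_cast hA.card_pos
  have h5 : (Fintype.card X : ℝ) * (A.card * c 0) ≤ F 0 * (A.card : ℝ) ^ 2 := by
    refine le_trans ?_ (h2 ▸ h1)
    gcongr
  nlinarith

/-- The function fed into Delsarte's inequalities. Multiplication by `K` on `X` is convolution by
`κ` on `H`; if `f ≥ 0` is a subsolution of the eigenvalue equation of that convolution for `lam`,
then `(K - θ) |f̂|²` has nonnegative Fourier coefficients for every `θ ≤ lam`. -/
theorem exists_delsarte_function (E : DualPairing X H) {κ : H → ℝ} {K : X → ℝ}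
    (hK : ∀ x, (K x : ℂ) = ∑ h, (κ h : ℂ) * E.toFun x h) {f : H → ℝ} (hf : ∀ h, 0 ≤ f h)
    {lam θ : ℝ} (hlam : ∀ h, lam * f h ≤ ∑ g, κ (h - g) * f g) (hθ : θ ≤ lam) :
    ∃ (F : X → ℝ) (c : H → ℝ), (∀ h, 0 ≤ c h) ∧ (lam - θ) * ∑ h, f h ^ 2 ≤ c 0 ∧
      (∀ x, (F x : ℂ) = ∑ h, (c h : ℂ) * E.toFun x h) ∧ (∀ x, K x ≤ θ → F x ≤ 0) ∧
      F 0 = (K 0 - θ) * (∑ h, f h) ^ 2 := by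
  -- The coefficients dominate a multiple of the autocorrelation of `f`.
  have hc : ∀ h, (lam - θ) * ∑ v, f v * f (v + h) ≤
      ∑ v, f v * ((∑ g, κ (v + h - g) * f g) - θ * f (v + h)) := by
    intro h
    rw [mul_sum]
    refine sum_le_sum fun v _ => ?_
    nlinarith [mul_le_mul_of_nonneg_left (hlam (v + h)) (hf v)]
  refine ⟨fun x => (K x - θ) * ‖∑ h, (f h : ℂ) * E.toFun x h‖ ^ 2,
    fun h => ∑ v, f v * ((∑ g, κ (v + h - g) * f g) - θ * f (v + h)), fun h => ?_, ?_, fun x => ?_,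
    fun x hx => mul_nonpos_of_nonpos_of_nonneg (by linarith) (sq_nonneg _), ?_⟩
  · exact (mul_nonneg (by linarith) (sum_nonneg fun v _ => mul_nonneg (hf _) (hf _))).trans (hc h)
  · refine le_trans (le_of_eq ?_) (hc 0)
    simp [sq]
  · have hw : ∀ w : H → ℂ, ∑ h, (∑ v, (f v : ℂ) * w (v + h)) * E.toFun x h =
        conj (∑ h, (f h : ℂ) * E.toFun x h) * ∑ h, w h * E.toFun x h := by
      intro w
      simp_rw [map_sum, sum_mul, mul_sum]
      rw [sum_comm]
      refine sum_congr rfl fun v _ => ?_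
      refine Fintype.sum_equiv (Equiv.addLeft v) _ _ fun h => ?_
      simp only [Equiv.coe_addLeft, E.add_right, map_mul, Complex.conj_ofReal]
      have : conj (E.toFun x v) * E.toFun x v = 1 := by
        rw [E.conj_right, ← E.add_right, neg_add_cancel, E.zero_right]
      linear_combination (-(f v : ℂ) * w (v + h) * E.toFun x h) * this
    have h1 : ∑ h, (∑ g, (κ (h - g) : ℂ) * f g) * E.toFun x h =
        K x * ∑ h, (f h : ℂ) * E.toFun x h := by
      simp_rw [hK, sum_mul, mul_sum]
      rw [sum_comm]
      rw [sum_comm (s := univ) (t := univ) (f := fun i j => (κ i : ℂ) * E.toFun x i * _)]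
      refine sum_congr rfl fun g _ => ?_
      refine Fintype.sum_equiv (Equiv.subRight g) _ _ fun h => ?_
      simp only [Equiv.subRight_apply]
      rw [show E.toFun x h = E.toFun x (h - g) * E.toFun x g by rw [← E.add_right]; simp]
      ring
    have h2 := hw fun h => (∑ g, (κ (h - g) : ℂ) * f g) - θ * f h
    push_cast
    rw [h2]
    simp_rw [sub_mul, sum_sub_distrib, h1, mul_assoc, ← mul_sum, ← Complex.conj_mul']
    ring
  · simp [E.zero_left, ← Complex.ofReal_sum]

/-- The spectral bound for codes: if `K ≤ θ` on all differences of distinct codewords then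
`|C| ≤ (K 0 - θ) (∑ f)² / ((lam - θ) ∑ f²)`. -/
theorem code_spectral_bound (E : DualPairing X H) {κ : H → ℝ} {K : X → ℝ}
    (hK : ∀ x, (K x : ℂ) = ∑ h, (κ h : ℂ) * E.toFun x h) {f : H → ℝ} (hf : ∀ h, 0 ≤ f h)
    {lam θ : ℝ} (hlam : ∀ h, lam * f h ≤ ∑ g, κ (h - g) * f g) (hθ : θ ≤ lam)
    (C : Finset X) (hC : C.Nonempty) (hd : ∀ x ∈ C, ∀ y ∈ C, x ≠ y → K (x - y) ≤ θ) :
    (lam - θ) * (∑ h, f h ^ 2) * C.card ≤ (K 0 - θ) * (∑ h, f h) ^ 2 := by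
  obtain ⟨F, c, hc, hc0, hF, hneg, hF0⟩ := E.exists_delsarte_function hK hf hlam hθ
  rw [← hF0]
  refine le_trans ?_ (E.card_le_of_nonpos hc hF C hC fun x hx y hy hxy => hneg _ (hd x hx y hy hxy))
  gcongr

/-- The spectral bound for designs: if the character sums of `A` vanish at all nonzero `x` with
`K x > θ`, then `|A| ≥ |X| (lam - θ) ∑ f² / ((K 0 - θ) (∑ f)²)`. -/
theorem design_spectral_bound (E : DualPairing X H) {κ : H → ℝ} {K : X → ℝ}
    (hK : ∀ x, (K x : ℂ) = ∑ h, (κ h : ℂ) * E.toFun x h) {f : H → ℝ} (hf : ∀ h, 0 ≤ f h)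
    {lam θ : ℝ} (hlam : ∀ h, lam * f h ≤ ∑ g, κ (h - g) * f g) (hθ : θ ≤ lam)
    (A : Finset H) (hA : A.Nonempty)
    (hd : ∀ x, x ≠ 0 → K x ≤ θ ∨ ∑ a ∈ A, E.toFun x a = 0) :
    (lam - θ) * (∑ h, f h ^ 2) * Fintype.card X ≤ (K 0 - θ) * (∑ h, f h) ^ 2 * A.card := by
  obtain ⟨F, c, hc, hc0, hF, hneg, hF0⟩ := E.exists_delsarte_function hK hf hlam hθ
  rw [← hF0]
  refine le_trans ?_ (E.le_card_of_nonpos hc hF A hA fun x hx => (hd x hx).imp_left (hneg x))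
  gcongr

end

end DualPairing

/-! ### Spectral radius of a nonnegative matrix on a subset -/

/-- A form of the Perron-Frobenius theorem for a symmetric nonnegative matrix restricted to a
nonempty index set `B`: a maximizer `f` of the Rayleigh quotient among the nonnegative vectors
supported on `B` is a subsolution of the eigenvalue equation, at every index. -/
theorem exists_nonneg_subeigenvector {H : Type*} [Fintype H] (M : H → H → ℝ)
    (hM : ∀ g h, 0 ≤ M g h) (hsymm : ∀ g h, M g h = M h g) (B : Set H) (hB : B.Nonempty) :
    ∃ (f : H → ℝ) (lam : ℝ), (∀ h, 0 ≤ f h) ∧ (∀ h, h ∉ B → f h = 0) ∧ ∑ h, f h ^ 2 = 1 ∧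
      0 ≤ lam ∧ (∀ h, lam * f h ≤ ∑ g, M h g * f g) ∧
      ∀ g : H → ℝ, (∀ h, 0 ≤ g h) → (∀ h, h ∉ B → g h = 0) →
        ∑ h, ∑ h', M h h' * g h * g h' ≤ lam * ∑ h, g h ^ 2 := by
  classical
  set S : Set (H → ℝ) := {f | (∀ h, 0 ≤ f h) ∧ (∀ h, h ∉ B → f h = 0) ∧ ∑ h, f h ^ 2 = 1} with hS
  set Φ : (H → ℝ) → ℝ := fun g => ∑ h, ∑ h', M h h' * g h * g h' with hΦ
  have hcl : IsClosed S := by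
    have h1 : IsClosed {f : H → ℝ | ∀ h, 0 ≤ f h} := by
      simp only [Set.ofPred_forall]
      exact isClosed_iInter fun i => isClosed_le continuous_const (continuous_apply i)
    have h2 : IsClosed {f : H → ℝ | ∀ h, h ∉ B → f h = 0} := by
      simp only [Set.ofPred_forall]
      exact isClosed_iInter fun i => isClosed_iInter fun _ =>
        isClosed_eq (continuous_apply i) continuous_const
    have h3 : IsClosed {f : H → ℝ | ∑ h, f h ^ 2 = 1} := isClosed_eq (by fun_prop) continuous_const
    exact h1.inter (h2.inter h3)
  have hcomp : IsCompact S := by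
    refine (isCompact_Icc (a := (0 : H → ℝ)) (b := fun _ => 1)).of_isClosed_subset hcl ?_
    rintro f ⟨h0, -, h1⟩
    refine ⟨fun i => h0 i, fun i => ?_⟩
    have := single_le_sum (f := fun h => f h ^ 2) (fun j _ => sq_nonneg _) (mem_univ i)
    simp only [h1] at this
    exact (sq_le_one_iff₀ (h0 i)).1 this
  have hne : S.Nonempty := by
    obtain ⟨b, hb⟩ := hB
    refine ⟨Pi.single b 1, fun h => ?_, fun h hh => ?_, ?_⟩
    · by_cases h' : h = b
      · subst h'; simp
      · simp [Pi.single_eq_of_ne h']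
    · exact Pi.single_eq_of_ne (by rintro rfl; exact hh hb) _
    · rw [sum_eq_single b]
      · simp
      · intro h _ h'; simp [Pi.single_eq_of_ne h']
      · simp
  have hcont : Continuous Φ := by fun_prop
  obtain ⟨f, ⟨hf0, hfB, hf1⟩, hmax⟩ := hcomp.exists_isMaxOn hne hcont.continuousOn
  have hΦ0 : ∀ g : H → ℝ, (∀ h, 0 ≤ g h) → 0 ≤ Φ g := fun g hg =>
    sum_nonneg fun h _ => sum_nonneg fun h' _ => mul_nonneg (mul_nonneg (hM _ _) (hg _)) (hg _)
  have hray : ∀ g : H → ℝ, (∀ h, 0 ≤ g h) → (∀ h, h ∉ B → g h = 0) →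
      Φ g ≤ Φ f * ∑ h, g h ^ 2 := by
    intro g hg0 hgB
    rcases (sum_nonneg fun h (_ : h ∈ univ) => sq_nonneg (g h)).eq_or_lt with h0 | hpos
    · have : ∀ h, g h = 0 := fun h => by
        have := (sum_eq_zero_iff_of_nonneg fun h _ => sq_nonneg (g h)).1 h0.symm h (mem_univ h)
        exact pow_eq_zero_iff (two_ne_zero) |>.1 this
      simp [hΦ, this]
    · set N := ∑ h, g h ^ 2 with hN
      have hs : Real.sqrt N ^ 2 = N := Real.sq_sqrt hpos.le
      have hs0 : 0 < Real.sqrt N := Real.sqrt_pos.2 hpos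
      have hmem : (fun h => g h / Real.sqrt N) ∈ S := by
        refine ⟨fun h => div_nonneg (hg0 h) hs0.le, fun h hh => by simp [hgB h hh], ?_⟩
        simp_rw [div_pow, ← sum_div, hs]
        exact div_self hpos.ne'
      have h1 : Φ (fun h => g h / Real.sqrt N) = Φ g / Real.sqrt N ^ 2 := by
        simp only [hΦ, sum_div]
        refine sum_congr rfl fun h _ => sum_congr rfl fun h' _ => ?_
        field_simp
      have h2 := hmax hmem
      simp only [Set.mem_ofPred_eq, h1, hs] at h2
      exact (div_le_iff₀ hpos).1 h2
  refine ⟨f, Φ f, hf0, hfB, hf1, hΦ0 f hf0, fun h => ?_, hray⟩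
  have hT0 : 0 ≤ ∑ g, M h g * f g := sum_nonneg fun g _ => mul_nonneg (hM _ _) (hf0 g)
  rcases (hf0 h).eq_or_lt with h0 | hpos
  · rw [← h0, mul_zero]; exact hT0
  by_contra! hlt
  -- Decreasing `f` at `h` by a small `ε` would increase the Rayleigh quotient.
  set T := ∑ g, M h g * f g with hT
  set lam := Φ f
  have hexp : ∀ ε, Φ (fun g => f g - ε * (Pi.single h 1 : H → ℝ) g)
      = lam - 2 * ε * T + ε ^ 2 * M h h := by
    intro ε
    have e1 : ∑ g, ∑ g', M g g' * f g * (Pi.single h 1 : H → ℝ) g' = T := by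
      rw [hT]
      refine sum_congr rfl fun g _ => ?_
      rw [sum_eq_single h]
      · simp [hsymm g h]
      · intro b _ hb; simp [Pi.single_eq_of_ne hb]
      · simp
    have e2 : ∑ g, ∑ g', M g g' * (Pi.single h 1 : H → ℝ) g * f g' = T := by
      rw [sum_eq_single h]
      · simp [hT]
      · intro b _ hb; simp [Pi.single_eq_of_ne hb]
      · simp
    have e3 : ∑ g, ∑ g', M g g' * (Pi.single h 1 : H → ℝ) g * (Pi.single h 1 : H → ℝ) g'
        = M h h := by
      rw [sum_eq_single h]
      · rw [sum_eq_single h]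
        · simp
        · intro b _ hb; simp [Pi.single_eq_of_ne hb]
        · simp
      · intro b _ hb; simp [Pi.single_eq_of_ne hb]
      · simp
    have : Φ (fun g => f g - ε * (Pi.single h 1 : H → ℝ) g) = lam
        - ε * (∑ g, ∑ g', M g g' * f g * (Pi.single h 1 : H → ℝ) g')
        - ε * (∑ g, ∑ g', M g g' * (Pi.single h 1 : H → ℝ) g * f g')
        + ε ^ 2 * ∑ g, ∑ g', M g g' * (Pi.single h 1 : H → ℝ) g * (Pi.single h 1 : H → ℝ) g' := by
      simp only [hΦ, lam, mul_sum, ← sum_sub_distrib, ← sum_add_distrib]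
      refine sum_congr rfl fun g _ => sum_congr rfl fun g' _ => ?_
      ring
    rw [this, e1, e2, e3]; ring
  have hnorm : ∀ ε, ∑ g, (f g - ε * (Pi.single h 1 : H → ℝ) g) ^ 2 = 1 - 2 * ε * f h + ε ^ 2 := by
    intro ε
    have e1 : ∑ g, f g * (Pi.single h 1 : H → ℝ) g = f h := by
      rw [sum_eq_single h]
      · simp
      · intro b _ hb; simp [Pi.single_eq_of_ne hb]
      · simp
    have e2 : ∑ g, (Pi.single h 1 : H → ℝ) g ^ 2 = 1 := by
      rw [sum_eq_single h]
      · simp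
      · intro b _ hb; simp [Pi.single_eq_of_ne hb]
      · simp
    have : ∑ g, (f g - ε * (Pi.single h 1 : H → ℝ) g) ^ 2 = ∑ g, f g ^ 2
        - 2 * ε * (∑ g, f g * (Pi.single h 1 : H → ℝ) g)
        + ε ^ 2 * ∑ g, (Pi.single h 1 : H → ℝ) g ^ 2 := by
      simp only [mul_sum, ← sum_sub_distrib, ← sum_add_distrib]
      exact sum_congr rfl fun g _ => by ring
    rw [this, e1, e2, hf1]; ring
  have hineq : ∀ ε, 0 < ε → ε ≤ f h → 2 * (lam * f h - T) ≤ ε * lam := by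
    intro ε hε hεf
    have h1 := hray (fun g => f g - ε * (Pi.single h 1 : H → ℝ) g) (fun g => ?_) (fun g hg => ?_)
    · rw [hexp, hnorm] at h1
      have h2 : 0 ≤ ε ^ 2 * M h h := mul_nonneg (sq_nonneg _) (hM _ _)
      have h3 : ε * (2 * (lam * f h - T)) ≤ ε * (ε * lam) := by nlinarith
      exact le_of_mul_le_mul_left h3 hε
    · by_cases hgh : g = h
      · subst hgh; simpa using hεf
      · simpa [Pi.single_eq_of_ne hgh] using hf0 g
    · have hgh : g ≠ h := fun hgh => by
        subst hgh; exact hpos.ne' (hfB g hg)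
      simp [Pi.single_eq_of_ne hgh, hfB g hg]
  have hlam : 0 ≤ lam := hΦ0 f hf0
  have hD : 0 < lam * f h - T := by linarith
  have h1 := hineq (min (f h) ((lam * f h - T) / (lam + 1)))
    (lt_min hpos (div_pos hD (by linarith))) (min_le_left _ _)
  have h2 : min (f h) ((lam * f h - T) / (lam + 1)) * lam ≤ lam * f h - T := by
    calc _ ≤ (lam * f h - T) / (lam + 1) * (lam + 1) :=
          mul_le_mul (min_le_right _ _) (by linarith) hlam (div_nonneg hD.le (by linarith))
      _ = _ := div_mul_cancel₀ _ (by linarith)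
  linarith

/-- Truncating a nonnegative vector of norm one to `B` changes its quadratic form little if the
mass outside of `B` is small; `S` bounds the row sums. -/
theorem quadratic_truncation_ge {H : Type*} [Fintype H] (M : H → H → ℝ)
    (hM : ∀ g h, 0 ≤ M g h) (hsymm : ∀ g h, M g h = M h g) {S : ℝ}
    (hS : ∀ g, ∑ h, M g h = S) (B : Set H) [DecidablePred (· ∈ B)] {f : H → ℝ}
    (hf : ∀ h, 0 ≤ f h) (hf1 : ∑ h, f h ^ 2 = 1) {s : ℝ} (hs : 0 < s) :
    ∑ h, ∑ g, M h g * f h * f g - S * (s * (∑ h, if h ∈ B then 0 else f h ^ 2) + 1 / s) ≤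
      ∑ h, ∑ g, M h g * (if h ∈ B then f h else 0) * (if g ∈ B then f g else 0) := by
  set fc : H → ℝ := fun h => if h ∈ B then 0 else f h with hfc
  set m := ∑ h, if h ∈ B then 0 else f h ^ 2 with hm
  have hfc2 : ∑ h, fc h ^ 2 = m := sum_congr rfl fun h _ => by
    by_cases hh : h ∈ B <;> simp [hfc, hh]
  have hfc0 : ∀ h, 0 ≤ fc h := fun h => by
    by_cases hh : h ∈ B <;> simp [hfc, hh, hf h]
  have hcross : ∑ h, ∑ g, M h g * fc h * f g ≤ S * (s * m / 2 + 1 / (2 * s)) := by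
    have h1 : ∀ h g, M h g * fc h * f g ≤ s / 2 * (M h g * fc h ^ 2) +
        1 / (2 * s) * (M h g * f g ^ 2) := by
      intro h g
      have : fc h * f g ≤ s / 2 * fc h ^ 2 + 1 / (2 * s) * f g ^ 2 := by
        have h3 : s / 2 * fc h ^ 2 + 1 / (2 * s) * f g ^ 2 - fc h * f g
            = (s * fc h - f g) ^ 2 / (2 * s) := by field_simp; ring
        have h4 : 0 ≤ (s * fc h - f g) ^ 2 / (2 * s) := by positivity
        linarith
      nlinarith [mul_le_mul_of_nonneg_left this (hM h g)]
    refine (sum_le_sum fun h _ => sum_le_sum fun g _ => h1 h g).trans ?_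
    simp_rw [sum_add_distrib]
    have e1 : ∑ h, ∑ g, M h g * fc h ^ 2 = S * m := by
      simp_rw [← sum_mul, hS, ← mul_sum, hfc2]
    have e2 : ∑ h, ∑ g, M h g * f g ^ 2 = S := by
      rw [sum_comm]
      simp_rw [← sum_mul]
      have : ∀ g, ∑ h, M h g = S := fun g => by simp_rw [hsymm _ g, hS]
      simp_rw [this, ← mul_sum, hf1, mul_one]
    simp_rw [← mul_sum]
    rw [e1, e2]
    apply le_of_eq; ring
  have hcross' : ∑ h, ∑ g, M h g * f h * fc g ≤ S * (s * m / 2 + 1 / (2 * s)) := by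
    refine le_trans (le_of_eq ?_) hcross
    rw [sum_comm]
    exact sum_congr rfl fun h _ => sum_congr rfl fun g _ => by rw [hsymm]; ring
  have hpt : ∑ h, ∑ g, M h g * f h * f g ≤ ∑ h, ∑ g, M h g * fc h * f g +
      ∑ h, ∑ g, M h g * f h * fc g +
      ∑ h, ∑ g, M h g * (if h ∈ B then f h else 0) * (if g ∈ B then f g else 0) := by
    simp_rw [← sum_add_distrib]
    refine sum_le_sum fun h _ => sum_le_sum fun g _ => ?_
    have := mul_nonneg (mul_nonneg (hM h g) (hf h)) (hf g)
    by_cases hh : h ∈ B <;> by_cases hg : g ∈ B <;> simp [hfc, hh, hg, this]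
  have : S * (s * m / 2 + 1 / (2 * s)) + S * (s * m / 2 + 1 / (2 * s)) = S * (s * m + 1 / s) := by
    field_simp; ring
  linarith

/-! ### Product functions on words of blocks -/

section Product

variable {B : Type*} [AddCommGroup B] [Fintype B]

/-- The convolution kernel on words of `n` blocks that changes a single block, by `b` with
weight `k b`. -/
noncomputable def piKernel (n : ℕ) (k : B → ℝ) (h : Fin n → B) : ℝ :=
  open Classical in ∑ i, ∑ b, if h = Pi.single i b then k b else 0

/-- The quadratic form `∑ k (a - b) φ a φ b` of the convolution by `k` on a single block. -/
noncomputable def blockForm (k : B → ℝ) (φ : B → ℝ) : ℝ :=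
  ∑ b, k b * ∑ a, φ (a + b) * φ a

/-- The number of nonzero blocks of a word. -/
noncomputable def numNonzero {n : ℕ} (h : Fin n → B) : ℕ :=
  open Classical in (univ.filter fun i => h i ≠ 0).card

lemma piKernel_nonneg {n : ℕ} {k : B → ℝ} (hk : ∀ b, 0 ≤ k b) (h : Fin n → B) :
    0 ≤ piKernel n k h := by
  unfold piKernel
  refine sum_nonneg fun i _ => sum_nonneg fun b _ => ?_
  split_ifs
  exacts [hk b, le_rfl]

lemma piKernel_neg {n : ℕ} {k : B → ℝ} (hk : ∀ b, k (-b) = k b) (h : Fin n → B) :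
    piKernel n k (-h) = piKernel n k h := by
  classical
  unfold piKernel
  refine sum_congr rfl fun i _ => ?_
  refine Fintype.sum_equiv (Equiv.neg B) _ _ fun b => ?_
  simp only [Equiv.neg_apply, hk, Pi.single_neg, neg_eq_iff_eq_neg]

lemma sum_piKernel_smul {M : Type*} [AddCommGroup M] [Module ℝ M] (n : ℕ) (k : B → ℝ)
    (G : (Fin n → B) → M) :
    ∑ h, piKernel n k h • G h = ∑ i, ∑ b, k b • G (Pi.single i b) := by
  classical
  unfold piKernel
  simp_rw [sum_smul]
  rw [sum_comm]
  refine sum_congr rfl fun i _ => ?_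
  rw [sum_comm]
  refine sum_congr rfl fun b _ => ?_
  simp [ite_smul]

lemma sum_piKernel (n : ℕ) (k : B → ℝ) : ∑ h, piKernel n k h = n * ∑ b, k b := by
  simpa using sum_piKernel_smul n k (fun _ => (1 : ℝ))

lemma sum_prod_eq_pow {B : Type*} [Fintype B] (n : ℕ) (w : B → ℝ) :
    ∑ h : Fin n → B, ∏ i, w (h i) = (∑ b, w b) ^ n := by
  rw [← Fintype.prod_sum]
  simp

/-- The quadratic form of `piKernel` is additive over the blocks at a product function. -/
lemma sum_piKernel_prod (n : ℕ) (k : B → ℝ) {φ : B → ℝ} (hφ : ∑ b, φ b ^ 2 = 1) :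
    ∑ h : Fin n → B, ∑ g, piKernel n k (h - g) * (∏ i, φ (h i)) * (∏ i, φ (g i))
      = n * blockForm k φ := by
  have h1 : ∑ h : Fin n → B, ∑ g, piKernel n k (h - g) * (∏ i, φ (h i)) * (∏ i, φ (g i))
      = ∑ u : Fin n → B, piKernel n k u • ∑ g : Fin n → B, ∏ i, (φ (g i + u i) * φ (g i)) := by
    rw [sum_comm]
    simp_rw [smul_sum]
    conv_rhs => rw [sum_comm]
    refine sum_congr rfl fun g _ => ?_
    refine Fintype.sum_equiv (Equiv.subRight g) _ _ fun h => ?_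
    simp [prod_mul_distrib, mul_assoc]
  rw [h1, sum_piKernel_smul]
  have h2 : ∀ (i : Fin n) (b : B), ∑ g : Fin n → B, ∏ j, (φ (g j + (Pi.single i b : Fin n → B) j)
      * φ (g j)) = ∑ a, φ (a + b) * φ a := by
    intro i b
    rw [← Fintype.prod_sum (fun j a => φ (a + (Pi.single i b : Fin n → B) j) * φ a),
      prod_eq_single i]
    · simp
    · intro j _ hj
      simp only [Pi.single_eq_of_ne hj, add_zero, ← sq, hφ]
    · simp
  simp_rw [h2, smul_eq_mul]
  simp [blockForm]

lemma prod_ite_eq_zero {B : Type*} [AddCommGroup B] [DecidableEq B] {n : ℕ} (h : Fin n → B)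
    (x y : ℝ) :
    ∏ i, (if h i = 0 then x else y) = y ^ numNonzero h * x ^ (n - numNonzero h) := by
  rw [prod_ite]
  simp only [prod_const, numNonzero]
  rw [mul_comm]
  congr 2
  · congr 1; ext; simp
  · have := card_filter_add_card_filter_not (s := (univ : Finset (Fin n))) (fun i => h i = 0)
    simp only [card_univ, Fintype.card_fin] at this
    refine (Nat.sub_eq_of_eq_add (this.symm.trans ?_)).symm
    congr! 3

lemma numNonzero_le {B : Type*} [AddCommGroup B] {n : ℕ} (h : Fin n → B) : numNonzero h ≤ n := by
  unfold numNonzero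
  exact (card_le_univ _).trans (by simp)

/-- The exponential moment estimate behind the concentration of the number of nonzero blocks. -/
lemma sum_prod_mul_exp_le (n : ℕ) {p : B → ℝ} {τ : ℝ} (hp1 : ∑ b, p b = 1)
    (hp0 : p 0 = 1 - τ) (h0 : 0 ≤ τ) (h1 : τ ≤ 1) {s : ℝ} (hs : |s| ≤ 1) :
    ∑ h : Fin n → B, (∏ i, p (h i)) * Real.exp (s * (numNonzero h - τ * n)) ≤
      Real.exp (n * s ^ 2) := by
  classical
  have e1 : ∀ h : Fin n → B, (∏ i, p (h i)) * Real.exp (s * (numNonzero h - τ * n)) =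
      Real.exp (-(s * τ)) ^ n * ∏ i, (p (h i) * if h i = 0 then 1 else Real.exp s) := by
    intro h
    rw [prod_mul_distrib, prod_ite_eq_zero, one_pow, mul_one, ← Real.exp_nat_mul,
      ← Real.exp_nat_mul]
    rw [mul_left_comm, ← Real.exp_add]
    congr 2; ring
  have e2 : ∑ b, (p b * if b = 0 then 1 else Real.exp s) = 1 + τ * (Real.exp s - 1) := by
    have h3 : ∀ b, (p b * if b = 0 then 1 else Real.exp s) =
        p b * Real.exp s + if b = 0 then p b * (1 - Real.exp s) else 0 := by
      intro b; split_ifs <;> ring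
    simp_rw [h3, sum_add_distrib, ← sum_mul, hp1]
    simp [hp0]; ring
  simp_rw [e1]
  rw [← mul_sum, sum_prod_eq_pow n (fun b => p b * if b = 0 then 1 else Real.exp s), e2,
    ← mul_pow]
  have e3 : Real.exp s - 1 ≤ s + s ^ 2 := by
    have := (abs_le.1 (Real.abs_exp_sub_one_sub_id_le hs)).2; linarith
  have e4 : 1 + τ * (Real.exp s - 1) ≤ Real.exp (s * τ + s ^ 2) := by
    refine le_trans ?_ (Real.add_one_le_exp _)
    nlinarith [sq_nonneg s]
  have e5 : 0 ≤ 1 + τ * (Real.exp s - 1) := by nlinarith [Real.exp_pos s]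
  rw [Real.exp_nat_mul]
  refine pow_le_pow_left₀ (mul_nonneg (Real.exp_pos _).le e5) ?_ n
  calc _ ≤ Real.exp (-(s * τ)) * Real.exp (s * τ + s ^ 2) := by gcongr
    _ = _ := by rw [← Real.exp_add]; congr 1; ring

/-- Under a product measure the number of nonzero blocks concentrates around its mean `τ n`. -/
lemma mass_outside_window_le (n : ℕ) {p : B → ℝ} {τ : ℝ} (hp : ∀ b, 0 ≤ p b)
    (hp1 : ∑ b, p b = 1) (hp0 : p 0 = 1 - τ) (h0 : 0 ≤ τ) (h1 : τ ≤ 1) {ε : ℝ} (hε : 0 < ε)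
    (hε1 : ε ≤ 1) (W : Set (Fin n → B)) [DecidablePred (· ∈ W)]
    (hW : W = {h | |(numNonzero h : ℝ) - τ * n| ≤ ε * n}) :
    ∑ h : Fin n → B, (if h ∈ W then 0 else ∏ i, p (h i)) ≤ 2 * Real.exp (-(ε ^ 2 / 4) * n) := by
  -- Chernoff's bound for both tails, with exponents `± ε / 2`.
  have key : ∀ h : Fin n → B, (if h ∈ W then 0 else ∏ i, p (h i)) ≤
      Real.exp (-(ε ^ 2 / 2) * n) * ((∏ i, p (h i)) * Real.exp (ε / 2 * (numNonzero h - τ * n))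
        + (∏ i, p (h i)) * Real.exp (-(ε / 2) * (numNonzero h - τ * n))) := by
    intro h
    have hP : 0 ≤ ∏ i, p (h i) := prod_nonneg fun i _ => hp _
    split_ifs with hh
    · positivity
    · rw [← mul_add, mul_left_comm, mul_add, ← Real.exp_add, ← Real.exp_add]
      refine le_mul_of_one_le_right hP ?_
      rw [hW] at hh
      simp only [Set.mem_ofPred_eq, not_le] at hh
      rcases lt_abs.1 hh with h3 | h3
      · refine le_add_of_le_of_nonneg (Real.one_le_exp ?_) (Real.exp_pos _).le
        nlinarith
      · refine le_add_of_nonneg_of_le (Real.exp_pos _).le (Real.one_le_exp ?_)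
        nlinarith
  refine (sum_le_sum fun h _ => key h).trans ?_
  rw [← mul_sum, sum_add_distrib]
  have b1 := sum_prod_mul_exp_le n hp1 hp0 h0 h1 (s := ε / 2)
    (by rw [abs_of_pos (by linarith)]; linarith)
  have b2 := sum_prod_mul_exp_le n hp1 hp0 h0 h1 (s := -(ε / 2))
    (by rw [abs_neg, abs_of_pos (by linarith)]; linarith)
  calc _ ≤ Real.exp (-(ε ^ 2 / 2) * n) * (Real.exp (n * (ε / 2) ^ 2) +
        Real.exp (n * (-(ε / 2)) ^ 2)) := by gcongr
    _ = _ := by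
      rw [neg_sq, ← two_mul, mul_left_comm, ← Real.exp_add]; congr 2; ring

/-- The number of words whose number of nonzero blocks is within `ε n` of `τ n`, on the
exponential scale. -/
lemma card_window_le (hB : 2 ≤ Fintype.card B) {τ : ℝ} (h0 : 0 < τ) (h1 : τ < 1) :
    ∃ c : ℝ, 0 < c ∧ ∀ (n : ℕ) (ε : ℝ), 0 < ε → ∀ W : Finset (Fin n → B),
      (∀ h ∈ W, |(numNonzero h : ℝ) - τ * n| ≤ ε * n) →
      (W.card : ℝ) ≤ Real.exp (n * (Real.qaryEntropy (Fintype.card B) τ + c * ε)) := by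
  classical
  set N := Fintype.card B with hN
  have hN1 : (0 : ℝ) < (N : ℝ) - 1 := by
    have : (2 : ℝ) ≤ N := by exact_mod_cast hB
    linarith
  have hy : 0 < τ / ((N : ℝ) - 1) := div_pos h0 hN1
  have hx : 0 < 1 - τ := by linarith
  set a := Real.log (τ / ((N : ℝ) - 1)) with ha
  set b := Real.log (1 - τ) with hb
  have hE : Real.qaryEntropy N τ = -(τ * a + (1 - τ) * b) := by
    rw [Real.qaryEntropy, Real.binEntropy, ha, hb, Real.log_div h0.ne' hN1.ne', Real.log_inv,
      Real.log_inv]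
    push_cast
    ring
  refine ⟨|a - b| + 1, by positivity, fun n ε hε W hW => ?_⟩
  -- The product measure of type `τ` gives each word of the window mass at least
  -- `exp (-n (qaryEntropy τ + c ε))`, and its total mass is one.
  have hsum : ∑ h : Fin n → B, ∏ i, (if h i = 0 then 1 - τ else τ / ((N : ℝ) - 1)) = 1 := by
    rw [sum_prod_eq_pow n (fun b => if b = 0 then 1 - τ else τ / ((N : ℝ) - 1))]
    rw [← add_sum_erase _ _ (mem_univ (0 : B)), if_pos rfl,
      sum_congr rfl (g := fun _ => τ / ((N : ℝ) - 1))
        (fun x hx => if_neg (ne_of_mem_erase hx))]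
    rw [sum_const, card_erase_of_mem (mem_univ _), card_univ, nsmul_eq_mul, ← hN,
      Nat.cast_sub (by omega)]
    push_cast
    rw [mul_div_cancel₀ _ hN1.ne']
    simp
  set e := Real.exp (-(n * (Real.qaryEntropy N τ + (|a - b| + 1) * ε))) with he
  have hlow : ∀ h ∈ W, e ≤ ∏ i, (if h i = 0 then 1 - τ else τ / ((N : ℝ) - 1)) := by
    intro h hh
    rw [prod_ite_eq_zero, ← Real.exp_log hy, ← Real.exp_log hx, ← Real.exp_nat_mul,
      ← Real.exp_nat_mul, ← Real.exp_add, ← ha, ← hb, Nat.cast_sub (numNonzero_le h)]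
    refine Real.exp_le_exp.2 ?_
    have h2 : |((numNonzero h : ℝ) - τ * n) * (a - b)| ≤ ε * n * |a - b| := by
      rw [abs_mul]; exact mul_le_mul_of_nonneg_right (hW h hh) (abs_nonneg _)
    have h3 := (abs_le.1 h2).1
    rw [hE]
    have h4 : 0 ≤ ε * n := by positivity
    nlinarith
  have h5 : W.card * e ≤ 1 := by
    rw [← nsmul_eq_mul, ← hsum]
    refine (card_nsmul_le_sum _ _ _ hlow).trans (sum_le_univ_sum_of_nonneg fun h => ?_)
    exact prod_nonneg fun i _ => by split_ifs <;> linarith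
  rw [he, Real.exp_neg, ← div_eq_mul_inv, div_le_one (Real.exp_pos _)] at h5
  exact h5

/-- The test function: for a unit vector `φ ≥ 0` on blocks with `φ 0 ^ 2 = 1 - τ`, there is a
subsolution of the eigenvalue equation on words with eigenvalue about `n * blockForm k φ` and with
support of size about `exp (n * qaryEntropy τ)`. -/
theorem exists_spectral_function (hB : 2 ≤ Fintype.card B) {k : B → ℝ} (hk : ∀ b, 0 ≤ k b)
    (hkn : ∀ b, k (-b) = k b) {φ : B → ℝ} (hφ : ∀ b, 0 ≤ φ b) (hφ1 : ∑ b, φ b ^ 2 = 1)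
    {τ : ℝ} (hφ0 : φ 0 ^ 2 = 1 - τ) (h0 : 0 < τ) (h1 : τ < 1) {η : ℝ} (hη : 0 < η) :
    ∃ n₀ : ℕ, ∀ n, n₀ ≤ n → ∃ f : (Fin n → B) → ℝ, (∀ h, 0 ≤ f h) ∧ ∑ h, f h ^ 2 = 1 ∧
      (∀ h, n * (blockForm k φ - η) * f h ≤ ∑ g, piKernel n k (h - g) * f g) ∧
      (∑ h, f h) ^ 2 ≤ Real.exp (n * (Real.qaryEntropy (Fintype.card B) τ + η)) := by
  classical
  obtain ⟨c, hc, hcard⟩ := card_window_le hB h0 h1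
  set ε := min 1 (η / c) with hε
  have hε0 : 0 < ε := lt_min one_pos (div_pos hη hc)
  have hcε : c * ε ≤ η := by
    calc c * ε ≤ c * (η / c) := by gcongr; exact min_le_right _ _
      _ = η := mul_div_cancel₀ _ hc.ne'
  set S := ∑ b, k b with hS
  have hS0 : 0 ≤ S := sum_nonneg fun b _ => hk b
  -- `s` is chosen so that both halves of the truncation error are at most `η / 2` per block.
  set s := 2 * (S + 1) / η with hs
  have hs0 : 0 < s := by positivity
  have hlim : Filter.Tendsto (fun n : ℕ => 2 * Real.exp (-(ε ^ 2 / 4) * n)) Filter.atTop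
      (nhds 0) := by
    have h2 : Filter.Tendsto (fun n : ℕ => -(ε ^ 2 / 4) * (n : ℝ)) Filter.atTop Filter.atBot :=
      tendsto_natCast_atTop_atTop.const_mul_atTop_of_neg (by nlinarith)
    simpa using (Real.tendsto_exp_atBot.comp h2).const_mul 2
  have hδ : 0 < min (1 / 2) (1 / s ^ 2) := by positivity
  obtain ⟨n₀, hn₀⟩ := Filter.eventually_atTop.1 (hlim.eventually_le_const hδ)
  refine ⟨n₀, fun n hn => ?_⟩
  set W : Set (Fin n → B) := {h | |(numNonzero h : ℝ) - τ * n| ≤ ε * n} with hW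
  set F : (Fin n → B) → ℝ := fun h => ∏ i, φ (h i) with hF
  have hF0 : ∀ h, 0 ≤ F h := fun h => prod_nonneg fun i _ => hφ _
  have hF2 : ∀ h, F h ^ 2 = ∏ i, φ (h i) ^ 2 := fun h => (prod_pow _ _ _).symm
  have hF1 : ∑ h, F h ^ 2 = 1 := by
    simp_rw [hF2]
    rw [sum_prod_eq_pow n (fun b => φ b ^ 2), hφ1, one_pow]
  have hmass : ∑ h, (if h ∈ W then 0 else F h ^ 2) ≤ min (1 / 2) (1 / s ^ 2) := by
    simp_rw [hF2]
    exact (mass_outside_window_le n (p := fun b => φ b ^ 2) (fun b => sq_nonneg _) hφ1 hφ0 h0.le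
      h1.le hε0 (min_le_left _ _) W hW).trans (hn₀ n hn)
  have hWne : W.Nonempty := by
    by_contra hemp
    rw [Set.not_nonempty_iff_eq_empty] at hemp
    have h2 := hmass.trans (min_le_left _ _)
    simp only [hemp, Set.mem_empty_iff_false, if_false, hF1] at h2
    norm_num at h2
  have hM0 : ∀ g h : Fin n → B, 0 ≤ piKernel n k (g - h) := fun g h => piKernel_nonneg hk _
  have hMs : ∀ g h : Fin n → B, piKernel n k (g - h) = piKernel n k (h - g) := fun g h => by
    rw [← piKernel_neg hkn, neg_sub]
  have hMS : ∀ g : Fin n → B, ∑ h, piKernel n k (g - h) = n * S := fun g => by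
    rw [← sum_piKernel]
    exact Fintype.sum_equiv (Equiv.subLeft g) _ _ fun h => rfl
  obtain ⟨f, lam, hf0, hfW, hf1, hlam0, hlam, hray⟩ :=
    exists_nonneg_subeigenvector (fun g h => piKernel n k (g - h)) hM0 hMs W hWne
  have htr := quadratic_truncation_ge (fun g h => piKernel n k (g - h)) hM0 hMs hMS W hF0 hF1 hs0
  rw [sum_piKernel_prod n k hφ1] at htr
  have hg := hray (fun h => if h ∈ W then F h else 0)
    (fun h => by split_ifs; exacts [hF0 h, le_rfl]) (fun h hh => if_neg hh)
  have hgn : ∑ h, (if h ∈ W then F h else 0) ^ 2 ≤ 1 := by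
    rw [← hF1]
    refine sum_le_sum fun h _ => ?_
    split_ifs
    · exact le_rfl
    · simpa using sq_nonneg (F h)
  have hlamn : n * (blockForm k φ - η) ≤ lam := by
    have h2 := hg.trans (mul_le_of_le_one_right hlam0 hgn)
    have h3 : S * (s * (∑ h, if h ∈ W then 0 else F h ^ 2) + 1 / s) ≤ η := by
      have h4 : s * (∑ h, if h ∈ W then 0 else F h ^ 2) ≤ 1 / s := by
        calc _ ≤ s * (1 / s ^ 2) := by
              gcongr; exact hmass.trans (min_le_right _ _)
          _ = 1 / s := by field_simp
      calc _ ≤ S * (1 / s + 1 / s) := by gcongr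
        _ = S / (S + 1) * η := by rw [hs]; field_simp; ring
        _ ≤ 1 * η := by gcongr; rw [div_le_one (by linarith)]; linarith
        _ = η := one_mul _
    have h5 : (n : ℝ) * (S * (s * (∑ h, if h ∈ W then 0 else F h ^ 2) + 1 / s)) ≤ n * η := by
      gcongr
    nlinarith
  refine ⟨f, hf0, hf1, fun h => (mul_le_mul_of_nonneg_right hlamn (hf0 h)).trans (hlam h), ?_⟩
  have hsum : ∑ h, f h = ∑ h ∈ univ.filter (· ∈ W), f h := by
    rw [sum_filter]
    exact sum_congr rfl fun h _ => by
      split_ifs with hh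
      exacts [rfl, hfW h hh]
  calc (∑ h, f h) ^ 2 ≤ (univ.filter (· ∈ W)).card * ∑ h ∈ univ.filter (· ∈ W), f h ^ 2 := by
        rw [hsum]; exact sq_sum_le_card_mul_sum_sq
    _ ≤ (univ.filter (· ∈ W)).card * 1 := by
        gcongr
        rw [← hf1]
        exact sum_le_univ_sum_of_nonneg fun h => sq_nonneg _
    _ ≤ Real.exp (n * (Real.qaryEntropy (Fintype.card B) τ + c * ε)) := by
        rw [mul_one]
        exact hcard n ε hε0 _ fun h hh => (mem_filter.1 hh).2
    _ ≤ _ := by gcongr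

end Product

/-! ### The quadratic form of a single block -/

section BlockForm

variable {B : Type*} [AddCommGroup B] [Fintype B]

lemma sum_mul_sq_sub_eq (k φ : B → ℝ) :
    ∑ b, ∑ a, k b * (φ (a + b) - φ a) ^ 2 =
      2 * ((∑ b, k b) * ∑ b, φ b ^ 2) - 2 * blockForm k φ := by
  unfold blockForm
  have h1 : ∀ b, ∑ a, φ (a + b) ^ 2 = ∑ a, φ a ^ 2 := fun b =>
    Fintype.sum_equiv (Equiv.addRight b) _ _ fun a => rfl
  have h2 : ∀ b, ∑ a, k b * (φ (a + b) - φ a) ^ 2 =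
      2 * (k b * ∑ a, φ a ^ 2) - 2 * (k b * ∑ a, φ (a + b) * φ a) := by
    intro b
    have h3 : k b * ∑ a, φ (a + b) ^ 2 = k b * ∑ a, φ a ^ 2 := by rw [h1]
    have h4 : ∑ a, k b * (φ (a + b) - φ a) ^ 2 = k b * ∑ a, φ (a + b) ^ 2 + k b * ∑ a, φ a ^ 2
        - 2 * (k b * ∑ a, φ (a + b) * φ a) := by
      simp_rw [mul_sum, ← sum_add_distrib, ← sum_sub_distrib]
      exact sum_congr rfl fun a _ => by ring
    rw [h4, h3]; ring
  simp_rw [h2, sum_sub_distrib, ← mul_sum, ← sum_mul]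

lemma blockForm_le {k φ : B → ℝ} (hk : ∀ b, 0 ≤ k b) (hφ1 : ∑ b, φ b ^ 2 = 1) :
    blockForm k φ ≤ ∑ b, k b := by
  have h1 := sum_mul_sq_sub_eq k φ
  have h2 : 0 ≤ ∑ b, ∑ a, k b * (φ (a + b) - φ a) ^ 2 :=
    sum_nonneg fun b _ => sum_nonneg fun a _ => mul_nonneg (hk b) (sq_nonneg _)
  rw [hφ1] at h1
  linarith

/-- For a positive kernel the top eigenvalue is attained at constant functions only. -/
lemma sq_eq_inv_card_of_blockForm_eq {k φ : B → ℝ} (hk : ∀ b, 0 < k b) (hφ1 : ∑ b, φ b ^ 2 = 1)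
    (h : blockForm k φ = ∑ b, k b) : φ 0 ^ 2 = (Fintype.card B : ℝ)⁻¹ := by
  have h1 := sum_mul_sq_sub_eq k φ
  rw [hφ1, h, mul_one, sub_self] at h1
  have hconst : ∀ b, φ b = φ 0 := by
    intro b
    have h2 := (sum_eq_zero_iff_of_nonneg fun b _ => sum_nonneg fun a _ =>
      mul_nonneg (hk b).le (sq_nonneg _)).1 h1 b (mem_univ b)
    have h3 := (sum_eq_zero_iff_of_nonneg fun a _ =>
      mul_nonneg (hk b).le (sq_nonneg _)).1 h2 0 (mem_univ _)
    rcases mul_eq_zero.1 h3 with h4 | h4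
    · exact absurd h4 (hk b).ne'
    · rw [zero_add] at h4
      exact sub_eq_zero.1 (pow_eq_zero_iff two_ne_zero |>.1 h4)
  simp_rw [hconst] at hφ1
  simp only [sum_const, card_univ, nsmul_eq_mul] at hφ1
  exact eq_inv_of_mul_eq_one_right hφ1

/-- The quadratic form of a nonnegative kernel is concave in the squares of the entries; this is
the case in which one of the two endpoints is the constant unit vector. -/
lemma exists_interpolation {k φ : B → ℝ} (hk : ∀ b, 0 ≤ k b) (hφ1 : ∑ b, φ b ^ 2 = 1)
    {s : ℝ} (hs0 : 0 ≤ s) (hs1 : s ≤ 1) :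
    ∃ ψ : B → ℝ, (∀ b, 0 ≤ ψ b) ∧ ∑ b, ψ b ^ 2 = 1 ∧
      ψ 0 ^ 2 = (1 - s) * φ 0 ^ 2 + s * (Fintype.card B : ℝ)⁻¹ ∧
      (1 - s) * blockForm k φ + s * ∑ b, k b ≤ blockForm k ψ := by
  set N : ℝ := (Fintype.card B : ℝ) with hN
  have hN0 : 0 < N := by
    have : 0 < Fintype.card B := Fintype.card_pos_iff.2 ⟨0⟩
    exact Nat.cast_pos.2 this
  have hnn : ∀ b, 0 ≤ (1 - s) * φ b ^ 2 + s * N⁻¹ := fun b =>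
    add_nonneg (mul_nonneg (by linarith) (sq_nonneg _)) (by positivity)
  refine ⟨fun b => Real.sqrt ((1 - s) * φ b ^ 2 + s * N⁻¹), fun b => Real.sqrt_nonneg _, ?_, ?_, ?_⟩
  · simp_rw [Real.sq_sqrt (hnn _), sum_add_distrib, ← mul_sum, hφ1]
    simp only [sum_const, card_univ, nsmul_eq_mul, ← hN]
    field_simp; ring
  · rw [Real.sq_sqrt (hnn _)]
  · have hpt : ∀ a b, (1 - s) * (φ a * φ b) + s * N⁻¹ ≤
        Real.sqrt ((1 - s) * φ a ^ 2 + s * N⁻¹) * Real.sqrt ((1 - s) * φ b ^ 2 + s * N⁻¹) := by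
      intro a b
      rw [← Real.sqrt_mul (hnn a)]
      refine Real.le_sqrt_of_sq_le ?_
      have h1 : 0 ≤ (1 - s) * (s * N⁻¹) * (φ a - φ b) ^ 2 :=
        mul_nonneg (mul_nonneg (by linarith) (by positivity)) (sq_nonneg _)
      nlinarith
    have h1 : (1 - s) * blockForm k φ + s * ∑ b, k b =
        ∑ b, k b * ∑ a, ((1 - s) * (φ (a + b) * φ a) + s * N⁻¹) := by
      unfold blockForm
      rw [mul_sum, mul_sum, ← sum_add_distrib]
      refine sum_congr rfl fun b _ => ?_
      rw [sum_add_distrib, ← mul_sum]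
      simp only [sum_const, card_univ, nsmul_eq_mul, ← hN]
      field_simp
    rw [h1]
    exact sum_le_sum fun b _ => mul_le_mul_of_nonneg_left (sum_le_sum fun a _ => hpt _ _) (hk b)

end BlockForm

/-! ### Ordered weight of blocks -/

section BlockWeight

variable {Q : Type*} [AddCommGroup Q] {r : ℕ}

lemma blockWeight_le_iff (b : Fin r → Q) (j : ℕ) :
    blockWeight b ≤ j ↔ ∀ l : Fin r, j ≤ l → b l = 0 := by
  classical
  unfold blockWeight
  rw [Finset.sup_le_iff]
  simp only [mem_filter, mem_univ, true_and]
  refine forall_congr' fun l => ⟨fun h hl => ?_, fun h hl => ?_⟩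
  · by_contra h0
    have := h h0
    omega
  · by_contra h0
    exact hl (h (by omega))

lemma blockWeight_le (b : Fin r → Q) : blockWeight b ≤ r :=
  (blockWeight_le_iff b r).2 fun l hl => absurd l.2 (by omega)

lemma blockWeight_zero : blockWeight (0 : Fin r → Q) = 0 :=
  Nat.le_zero.1 ((blockWeight_le_iff _ 0).2 fun _ _ => rfl)

lemma blockWeight_neg (b : Fin r → Q) : blockWeight (-b) = blockWeight b := by
  refine le_antisymm ?_ ?_
  · exact (blockWeight_le_iff _ _).2 fun l hl => by
      simp [(blockWeight_le_iff b _).1 le_rfl l hl]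
  · refine (blockWeight_le_iff _ _).2 fun l hl => ?_
    simpa using (blockWeight_le_iff (-b) _).1 le_rfl l hl

lemma blockWeight_sub_le (a b : Fin r → Q) :
    blockWeight (a - b) ≤ max (blockWeight a) (blockWeight b) := by
  refine (blockWeight_le_iff _ _).2 fun l hl => ?_
  have h1 := (blockWeight_le_iff a _).1 le_rfl l ((le_max_left _ _).trans hl)
  have h2 := (blockWeight_le_iff b _).1 le_rfl l ((le_max_right _ _).trans hl)
  simp [h1, h2]

/-- The ordered weight of a word is the sum of the weights of its blocks. -/
lemma weight_eq_sum {n : ℕ} (x : Fin n → Fin r → Q) : weight x = ∑ i, blockWeight (x i) := by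
  classical
  unfold weight shape
  simp_rw [card_filter, mul_sum]
  rw [sum_comm]
  refine sum_congr rfl fun i _ => ?_
  rcases Nat.eq_zero_or_pos (blockWeight (x i)) with h0 | hpos
  · rw [h0]
    exact sum_eq_zero fun j _ => by simp
  · have hlt : blockWeight (x i) - 1 < r := by have := blockWeight_le (x i); omega
    rw [sum_eq_single ⟨blockWeight (x i) - 1, hlt⟩]
    · rw [if_pos (by simp only []; omega)]; simp only []; omega
    · intro j _ hj
      rw [if_neg, mul_zero]
      intro h
      exact hj (Fin.ext (by simp only []; omega))
    · simp

/-- The sum of `q ^ (-j)` over the levels `1 ≤ j ≤ r` with `w ≤ j`. -/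
noncomputable def levelSum (q r w : ℕ) : ℝ :=
  ∑ m : Fin r, if w ≤ (m : ℕ) + 1 then ((q : ℝ) ^ ((m : ℕ) + 1))⁻¹ else 0

lemma levelSum_antitone (q r : ℕ) {v w : ℕ} (h : v ≤ w) : levelSum q r w ≤ levelSum q r v := by
  refine sum_le_sum fun m _ => ?_
  split_ifs with h1 h2 h2
  · exact le_rfl
  · exact absurd (h.trans h1) h2
  · positivity
  · exact le_rfl

lemma levelSum_pos {q r w : ℕ} (hq : 0 < q) (hr : 1 ≤ r) (hw : w ≤ r) : 0 < levelSum q r w := by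
  refine sum_pos' (fun m _ => ?_) ⟨⟨r - 1, by omega⟩, mem_univ _, ?_⟩
  · split_ifs <;> positivity
  · rw [if_pos (by simp only []; omega)]; positivity

lemma levelSum_succ_eq_coeffL {q r : ℕ} (hq : 2 ≤ q) (i : Fin r) :
    levelSum q r ((i : ℕ) + 1) = coeffL q r i := by
  have hq1 : (q : ℝ) - 1 ≠ 0 := by
    have : (2 : ℝ) ≤ q := by exact_mod_cast hq
    linarith
  have hq0 : (q : ℝ) ≠ 0 := by
    have : (2 : ℝ) ≤ q := by exact_mod_cast hq
    linarith
  obtain ⟨i, hi⟩ := i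
  unfold levelSum coeffL
  simp only [add_le_add_iff_right]
  rw [Fin.sum_univ_eq_sum_range (fun m => if i ≤ m then ((q : ℝ) ^ (m + 1))⁻¹ else 0) r]
  have key : ∀ s, i ≤ s → ∑ m ∈ range s, (if i ≤ m then ((q : ℝ) ^ (m + 1))⁻¹ else 0) =
      ((q : ℝ) ^ (s - i) - 1) / ((q : ℝ) ^ s * ((q : ℝ) - 1)) := by
    intro s hs
    induction s, hs using Nat.le_induction with
    | base =>
      rw [Nat.sub_self, pow_zero, sub_self, zero_div]
      exact sum_eq_zero fun m hm => if_neg (by have := mem_range.1 hm; omega)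
    | succ s hs ih =>
      rw [sum_range_succ, ih, if_pos hs, Nat.succ_sub hs, pow_succ, pow_succ]
      field_simp
      ring
  exact key r hi.le

lemma levelSum_zero_eq {q r : ℕ} (hr : 1 ≤ r) :
    levelSum q r 0 = r - r * deltaCrit q r := by
  have h0 : (r : ℝ) ≠ 0 := by positivity
  unfold levelSum deltaCrit
  simp only [Nat.zero_le, if_true]
  rw [Fin.sum_univ_eq_sum_range (fun m => ((q : ℝ) ^ (m + 1))⁻¹) r,
    range_eq_Ico, sum_Ico_add' (fun m => ((q : ℝ) ^ m)⁻¹) 0 r 1, zero_add,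
    show Ico 1 (r + 1) = Icc 1 r by ext; simp]
  field_simp
  ring

/-- The kernel on blocks whose Fourier transform is `r - blockWeight`. -/
noncomputable def blockKernel (q : ℕ) {r : ℕ} (b : Fin r → Q) : ℝ := levelSum q r (blockWeight b)

end BlockWeight

section Fourier

variable {Q₁ Q₂ : Type*} [AddCommGroup Q₁] [Fintype Q₁] [AddCommGroup Q₂] [Fintype Q₂] {r : ℕ}

/-- The character sum over the blocks of weight at most `j`, which form a subgroup. -/
lemma sum_rev_blockWeight_le (E : DualPairing Q₁ Q₂) (x : Fin r → Q₁) {j : ℕ} (hj : j ≤ r) :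
    ∑ b : Fin r → Q₂, (if blockWeight b ≤ j then (E.rev r).toFun x b else 0) =
      if blockWeight x ≤ r - j then (Fintype.card Q₂ : ℂ) ^ j else 0 := by
  classical
  have h1 : ∀ b : Fin r → Q₂, blockWeight b ≤ j ↔
      b ∈ Fintype.piFinset (fun l : Fin r => if j ≤ (l : ℕ) then ({0} : Finset Q₂) else univ) := by
    intro b
    rw [blockWeight_le_iff, Fintype.mem_piFinset]
    refine forall_congr' fun l => ?_
    split_ifs with h <;> simp [h]
  have h2 : ∀ b : Fin r → Q₂, (E.rev r).toFun x b = ∏ l : Fin r, E.toFun (x l.rev) (b l) := by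
    intro b
    change ∏ l : Fin r, E.toFun (x l) (b l.rev) = _
    exact Fintype.prod_equiv Fin.revPerm _ _ fun l => by simp
  simp_rw [h1, h2]
  rw [← sum_filter, filter_mem_eq_inter, univ_inter, ← prod_univ_sum]
  have h3 : ∀ l : Fin r, ∑ p ∈ (if j ≤ (l : ℕ) then ({0} : Finset Q₂) else univ),
      E.toFun (x l.rev) p = if j ≤ (l : ℕ) then 1 else
        if x l.rev = 0 then (Fintype.card Q₂ : ℂ) else 0 := by
    intro l
    split_ifs with h h0
    · simp [E.zero_right]
    · simp [h0, E.zero_left]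
    · exact E.sum_right _ h0
  simp_rw [h3]
  split_ifs with hx
  · rw [blockWeight_le_iff] at hx
    have h4 : ∀ l : Fin r, (if j ≤ (l : ℕ) then (1 : ℂ) else
        if x l.rev = 0 then (Fintype.card Q₂ : ℂ) else 0) =
        if (l : ℕ) < j then (Fintype.card Q₂ : ℂ) else 1 := by
      intro l
      by_cases hl : j ≤ (l : ℕ)
      · rw [if_pos hl, if_neg (not_lt.2 hl)]
      · rw [if_neg hl, if_pos (not_le.1 hl), if_pos (hx _ (by rw [Fin.val_rev]; omega))]
    simp_rw [h4]
    rw [Fin.prod_univ_eq_prod_range (fun l => if l < j then (Fintype.card Q₂ : ℂ) else 1) r,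
      ← prod_filter, prod_const]
    congr 1
    rw [show (range r).filter (· < j) = range j by ext; simp; omega, card_range]
  · rw [blockWeight_le_iff] at hx
    push Not at hx
    obtain ⟨m, hm, hm0⟩ := hx
    refine prod_eq_zero (mem_univ m.rev) ?_
    rw [if_neg (by rw [Fin.val_rev]; omega), Fin.rev_rev, if_neg hm0]

/-- The Fourier transform of the block kernel. -/
lemma sum_blockKernel_mul (E : DualPairing Q₁ Q₂) {q : ℕ} (hq : 0 < q)
    (hQ : Fintype.card Q₂ = q) (x : Fin r → Q₁) :
    ∑ b : Fin r → Q₂, (blockKernel q b : ℂ) * (E.rev r).toFun x b = r - blockWeight x := by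
  have hq0 : (q : ℂ) ≠ 0 := by exact_mod_cast hq.ne'
  have h1 : ∀ b : Fin r → Q₂, (blockKernel q b : ℂ) * (E.rev r).toFun x b =
      ∑ m : Fin r, ((q : ℂ) ^ ((m : ℕ) + 1))⁻¹ *
        (if blockWeight b ≤ (m : ℕ) + 1 then (E.rev r).toFun x b else 0) := by
    intro b
    unfold blockKernel levelSum
    push_cast
    rw [sum_mul]
    refine sum_congr rfl fun m _ => ?_
    split_ifs <;> simp
  simp_rw [h1]
  rw [sum_comm]
  have h2 : ∀ m : Fin r, ∑ b : Fin r → Q₂, ((q : ℂ) ^ ((m : ℕ) + 1))⁻¹ *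
        (if blockWeight b ≤ (m : ℕ) + 1 then (E.rev r).toFun x b else 0) =
      if (m : ℕ) < r - blockWeight x then 1 else 0 := by
    intro m
    rw [← mul_sum, sum_rev_blockWeight_le E x (by omega), hQ]
    have := blockWeight_le x
    by_cases h : (m : ℕ) < r - blockWeight x
    · rw [if_pos h, if_pos (by omega), inv_mul_cancel₀ (pow_ne_zero _ hq0)]
    · rw [if_neg h, if_neg (by omega), mul_zero]
  simp_rw [h2]
  rw [Fin.sum_univ_eq_sum_range (fun m => if m < r - blockWeight x then (1 : ℂ) else 0) r,
    ← sum_filter, show (range r).filter (· < r - blockWeight x) = range (r - blockWeight x) by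
      ext; simp; omega]
  simp [Nat.cast_sub (blockWeight_le x)]

end Fourier

section Counting

variable {Q : Type*} [AddCommGroup Q] [Fintype Q] {q r : ℕ}

lemma card_blockWeight_le (hQ : Fintype.card Q = q) {j : ℕ} (hj : j ≤ r) :
    (univ.filter fun b : Fin r → Q => blockWeight b ≤ j).card = q ^ j := by
  let E := (DualPairing.ofAddChar Q).flip
  have h := sum_rev_blockWeight_le E (0 : Fin r → AddChar Q ℂ) hj
  simp only [(E.rev r).zero_left, blockWeight_zero, Nat.zero_le, if_true, hQ] at h
  rw [sum_boole] at h
  exact_mod_cast h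

lemma sum_blockKernel (hq : 0 < q) (hQ : Fintype.card Q = q) :
    ∑ b : Fin r → Q, blockKernel q b = r := by
  let E := (DualPairing.ofAddChar Q).flip
  have := sum_blockKernel_mul E hq hQ (0 : Fin r → AddChar Q ℂ)
  simp only [(E.rev r).zero_left, mul_one, blockWeight_zero, Nat.cast_zero, sub_zero] at this
  exact_mod_cast this

/-- Summation over blocks of a function of the weight: there are `(q - 1) q ^ i` blocks of weight
`i + 1`. -/
lemma sum_comp_blockWeight (hQ : Fintype.card Q = q) (G : ℕ → ℝ) :
    ∑ b : Fin r → Q, G (blockWeight b) =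
      G 0 + ∑ i : Fin r, ((q : ℝ) - 1) * (q : ℝ) ^ (i : ℕ) * G ((i : ℕ) + 1) := by
  classical
  rw [← sum_fiberwise_of_maps_to (t := range (r + 1)) (g := fun b : Fin r → Q => blockWeight b)
    (fun b _ => mem_range.2 (Nat.lt_succ_of_le (blockWeight_le b))), sum_range_succ', add_comm,
    ← Fin.sum_univ_eq_sum_range (fun w => ∑ b : Fin r → Q with blockWeight b = w + 1,
      G (blockWeight b)) r]
  have hfib : ∀ w, ∑ b : Fin r → Q with blockWeight b = w, G (blockWeight b) =
      (univ.filter fun b : Fin r → Q => blockWeight b = w).card * G w := by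
    intro w
    rw [← nsmul_eq_mul, ← sum_const]
    exact sum_congr rfl fun b hb => by rw [(mem_filter.1 hb).2]
  congr 1
  · have h0 := card_blockWeight_le (r := r) hQ (Nat.zero_le r)
    simp only [Nat.le_zero, pow_zero] at h0
    rw [hfib, h0, Nat.cast_one, one_mul]
  · refine sum_congr rfl fun i _ => ?_
    rw [hfib]
    congr 1
    have h1 := card_blockWeight_le (r := r) hQ (j := (i : ℕ) + 1) (by omega)
    have h2 := card_blockWeight_le (r := r) hQ (j := (i : ℕ)) (by omega)
    have h3 : (univ.filter fun b : Fin r → Q => blockWeight b ≤ (i : ℕ) + 1) =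
        (univ.filter fun b : Fin r → Q => blockWeight b ≤ (i : ℕ)) ∪
        (univ.filter fun b : Fin r → Q => blockWeight b = (i : ℕ) + 1) := by
      ext b; simp only [mem_filter, mem_univ, true_and, mem_union]; omega
    rw [h3, card_union_of_disjoint, h2] at h1
    · have h4 : ((q : ℝ) ^ (i : ℕ)) + ((univ.filter fun b : Fin r → Q =>
          blockWeight b = (i : ℕ) + 1).card : ℝ) = (q : ℝ) ^ ((i : ℕ) + 1) := by exact_mod_cast h1
      rw [pow_succ] at h4
      linear_combination h4
    · exact disjoint_filter.2 fun b _ hb => by omega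

/-- A quadratic form whose coefficients depend on the larger index only. -/
lemma sum_sum_max {r : ℕ} (L y : Fin r → ℝ) :
    ∑ i, ∑ k, L (max i k) * y i * y k =
      ∑ i, L i * (y i ^ 2 + 2 * (y i * ∑ k with k < i, y k)) := by
  have h1 : ∀ i k, L (max i k) * y i * y k = (if k < i then L i * y i * y k else 0) +
      (if i < k then L k * y k * y i else 0) + (if i = k then L i * y i * y k else 0) := by
    intro i k
    rcases lt_trichotomy i k with h | h | h
    · simp [max_eq_right h.le, h, h.not_gt, h.ne]; ring
    · simp [h]
    · simp [max_eq_left h.le, h, h.not_gt, h.ne']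
  simp_rw [h1, sum_add_distrib]
  rw [sum_comm (f := fun i k => if i < k then L k * y k * y i else 0), ← sum_add_distrib,
    ← sum_add_distrib]
  refine sum_congr rfl fun i _ => ?_
  simp only [sum_ite_eq, mem_univ, if_true, mul_sum, ← sum_filter, mul_add]
  have h2 : ∑ k with k < i, L i * (2 * (y i * y k)) = 2 * ∑ k with k < i, L i * y i * y k := by
    rw [mul_sum]
    exact sum_congr rfl fun k _ => by ring
  rw [h2]; ring

/-- A test function on blocks, constant on each weight class, whose quadratic form is at least
`Λ`, up to the diagonal contribution of the kernel. -/
theorem exists_blockForm_ge_Lam (hQ : Fintype.card Q = q) (hq : 2 ≤ q) {t : Fin r → ℝ}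
    (ht : ∀ i, 0 ≤ t i) (ht1 : ∑ i, t i ≤ 1) :
    ∃ φ : (Fin r → Q) → ℝ, (∀ b, 0 ≤ φ b) ∧ ∑ b, φ b ^ 2 = 1 ∧ φ 0 ^ 2 = 1 - ∑ i, t i ∧
      levelSum q r 0 + Lam q r t ≤ blockForm (blockKernel q) φ := by
  classical
  have hq2 : (2 : ℝ) ≤ q := by exact_mod_cast hq
  have hq0 : (0 : ℝ) < q := by linarith
  have hN : ∀ i : ℕ, 0 < ((q : ℝ) - 1) * (q : ℝ) ^ i := fun i =>
    mul_pos (by linarith) (pow_pos hq0 i)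
  -- The mass `t i` is spread evenly over the `(q - 1) q ^ i` blocks of weight `i + 1`.
  let s : ℕ → ℝ := fun w => if w = 0 then Real.sqrt (1 - ∑ i, t i) else
    if h : w - 1 < r then Real.sqrt (t ⟨w - 1, h⟩) / Real.sqrt (((q : ℝ) - 1) * (q : ℝ) ^ (w - 1))
    else 0
  have hs0 : s 0 = Real.sqrt (1 - ∑ i, t i) := if_pos rfl
  have hs1 : ∀ i : Fin r, s ((i : ℕ) + 1) =
      Real.sqrt (t i) / Real.sqrt (((q : ℝ) - 1) * (q : ℝ) ^ (i : ℕ)) := fun i => by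
    simp [s]
  have hsn : ∀ w, 0 ≤ s w := fun w => by
    simp only [s]; split_ifs <;> positivity
  have hs0sq : s 0 ^ 2 = 1 - ∑ i, t i := by rw [hs0, Real.sq_sqrt (by linarith)]
  have hs1sq : ∀ i : Fin r, ((q : ℝ) - 1) * (q : ℝ) ^ (i : ℕ) * s ((i : ℕ) + 1) ^ 2 = t i := by
    intro i
    rw [hs1, div_pow, Real.sq_sqrt (ht i), Real.sq_sqrt (hN i).le, mul_div_cancel₀ _ (hN i).ne']
  set y : Fin r → ℝ := fun i => ((q : ℝ) - 1) * (q : ℝ) ^ (i : ℕ) * s ((i : ℕ) + 1) with hy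
  have hysqrt : ∀ i, y i = Real.sqrt (t i) * Real.sqrt (((q : ℝ) - 1) * (q : ℝ) ^ (i : ℕ)) := by
    intro i
    simp only [hy, hs1]
    nth_rewrite 1 [← Real.mul_self_sqrt (hN i).le]
    have := (Real.sqrt_pos.2 (hN i)).ne'
    field_simp
  have hysq : ∀ i, y i ^ 2 = t i * (((q : ℝ) - 1) * (q : ℝ) ^ (i : ℕ)) := fun i => by
    rw [hysqrt, mul_pow, Real.sq_sqrt (ht i), Real.sq_sqrt (hN i).le]
  refine ⟨fun b => s (blockWeight b), fun b => hsn _, ?_, ?_, ?_⟩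
  · rw [sum_comp_blockWeight hQ (fun w => s w ^ 2), hs0sq]
    simp_rw [hs1sq]
    ring
  · simp only [blockWeight_zero, hs0sq]
  -- Off the diagonal `k (b - a)` is at least its value at the larger of the two weights.
  have hform : blockForm (blockKernel q) (fun b : Fin r → Q => s (blockWeight b)) =
      ∑ a : Fin r → Q, ∑ b, blockKernel q (b - a) * (s (blockWeight b) * s (blockWeight a)) := by
    unfold blockForm
    simp_rw [mul_sum]
    rw [sum_comm]
    refine sum_congr rfl fun a _ => ?_
    refine Fintype.sum_equiv (Equiv.addLeft a) _ _ fun b => ?_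
    simp
  have hpt : ∀ a b : Fin r → Q,
      levelSum q r (max (blockWeight a) (blockWeight b)) * s (blockWeight a) * s (blockWeight b) +
        (if b = a then (levelSum q r 0 - levelSum q r (blockWeight a)) * s (blockWeight a) ^ 2
          else 0) ≤
      blockKernel q (b - a) * (s (blockWeight b) * s (blockWeight a)) := by
    intro a b
    split_ifs with h
    · subst h
      simp only [blockKernel, sub_self, blockWeight_zero, max_self]
      apply le_of_eq; ring
    · rw [add_zero, mul_assoc, mul_comm (s (blockWeight a))]
      refine mul_le_mul_of_nonneg_right ?_ (mul_nonneg (hsn _) (hsn _))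
      exact levelSum_antitone q r (max_comm (blockWeight a) _ ▸ blockWeight_sub_le b a)
  have hlow := sum_le_sum fun a (_ : a ∈ univ) => sum_le_sum fun b (_ : b ∈ univ) => hpt a b
  rw [← hform] at hlow
  refine le_trans ?_ hlow
  simp_rw [sum_add_distrib]
  simp only [sum_ite_eq', mem_univ, if_true]
  have hD2 : ∑ a : Fin r → Q, (levelSum q r 0 - levelSum q r (blockWeight a)) *
      s (blockWeight a) ^ 2 = ∑ i, (levelSum q r 0 - coeffL q r i) * t i := by
    rw [sum_comp_blockWeight hQ (fun w => (levelSum q r 0 - levelSum q r w) * s w ^ 2), sub_self,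
      zero_mul, zero_add]
    refine sum_congr rfl fun i _ => ?_
    rw [levelSum_succ_eq_coeffL hq, ← hs1sq i]; ring
  have hD1 : ∑ a : Fin r → Q, ∑ b : Fin r → Q, levelSum q r (max (blockWeight a) (blockWeight b)) *
      s (blockWeight a) * s (blockWeight b) = levelSum q r 0 * s 0 ^ 2 +
      2 * (∑ i, coeffL q r i * s 0 * y i) +
      ∑ i, coeffL q r i * (y i ^ 2 + 2 * (y i * ∑ k with k < i, y k)) := by
    have h1 : ∀ a : Fin r → Q, ∑ b : Fin r → Q,
        levelSum q r (max (blockWeight a) (blockWeight b)) * s (blockWeight a) * s (blockWeight b)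
        = levelSum q r (blockWeight a) * s (blockWeight a) * s 0 + ∑ i : Fin r,
          levelSum q r (max (blockWeight a) ((i : ℕ) + 1)) * s (blockWeight a) * y i := by
      intro a
      rw [sum_comp_blockWeight hQ (fun w => levelSum q r (max (blockWeight a) w) *
        s (blockWeight a) * s w), max_eq_left (Nat.zero_le _)]
      congr 1
      exact sum_congr rfl fun i _ => by simp only [hy]; ring
    simp_rw [h1]
    rw [sum_comp_blockWeight hQ (fun w => levelSum q r w * s w * s 0 + ∑ i : Fin r,
      levelSum q r (max w ((i : ℕ) + 1)) * s w * y i), ← sum_sum_max]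
    simp only [Nat.zero_max, levelSum_succ_eq_coeffL hq]
    have h2 : ∀ i k : Fin r, levelSum q r (max ((i : ℕ) + 1) ((k : ℕ) + 1)) =
        coeffL q r (max i k) := by
      intro i k
      rw [← levelSum_succ_eq_coeffL hq]
      congr 1
      rw [Fin.coe_max]; omega
    simp_rw [h2]
    have h3 : ∑ i : Fin r, ((q : ℝ) - 1) * (q : ℝ) ^ (i : ℕ) * (coeffL q r i * s ((i : ℕ) + 1) * s 0
        + ∑ k, coeffL q r (max i k) * s ((i : ℕ) + 1) * y k) =
        (∑ i, coeffL q r i * s 0 * y i) + ∑ i, ∑ k, coeffL q r (max i k) * y i * y k := by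
      rw [← sum_add_distrib]
      refine sum_congr rfl fun i _ => ?_
      rw [mul_add, mul_sum]
      congr 1
      · simp only [hy]; ring
      · exact sum_congr rfl fun k _ => by simp only [hy]; ring
    rw [h3]
    ring
  rw [hD1, hD2, hs0sq]
  have hLam : Lam q r t ≤ 2 * (∑ i, coeffL q r i * s 0 * y i) +
      ∑ i, coeffL q r i * (y i ^ 2 + 2 * (y i * ∑ k with k < i, y k)) -
      ∑ i, coeffL q r i * t i := by
    unfold Lam
    rw [mul_sum, ← sum_add_distrib, ← sum_sub_distrib]
    refine sum_le_sum fun i _ => ?_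
    have hL : 0 ≤ coeffL q r i := by
      rw [← levelSum_succ_eq_coeffL hq]
      exact (levelSum_pos (by omega) (Fin.pos i) i.2).le
    have e1 : Real.sqrt ((1 - ∑ j, t j) * t i * ((q : ℝ) - 1) * (q : ℝ) ^ (i : ℕ)) = s 0 * y i := by
      rw [hs0, hysqrt, ← Real.sqrt_mul (ht i), ← Real.sqrt_mul (by linarith)]
      congr 1; ring
    have e2 : ((q : ℝ) - 1) / (q : ℝ) * ∑ k with k < i,
        Real.sqrt (t k * t i * (q : ℝ) ^ (((i : ℕ) + 1) + ((k : ℕ) + 1))) =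
        y i * ∑ k with k < i, y k := by
      rw [mul_sum, mul_sum]
      refine sum_congr rfl fun k _ => ?_
      rw [hysqrt, hysqrt]
      have hc : 0 ≤ ((q : ℝ) - 1) / q := div_nonneg (by linarith) hq0.le
      rw [← Real.sqrt_mul (ht i), ← Real.sqrt_mul (ht k),
        ← Real.sqrt_mul (mul_nonneg (ht i) (hN i).le)]
      nth_rewrite 1 [← Real.sqrt_sq hc]
      rw [← Real.sqrt_mul (sq_nonneg _)]
      congr 1
      rw [show ((i : ℕ) + 1) + ((k : ℕ) + 1) = (i : ℕ) + (k : ℕ) + 2 by ring, pow_add, pow_add]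
      field_simp
    -- On the diagonal `Λ` keeps only the pairs whose difference has the same weight `i + 1`; the
    -- other pairs in the weight class contribute a nonnegative excess.
    have e3 : ((q : ℝ) - 2) * t i * (q : ℝ) ^ (i : ℕ) ≤ y i ^ 2 - t i := by
      rw [hysq]
      have : (1 : ℝ) ≤ (q : ℝ) ^ (i : ℕ) := one_le_pow₀ (by linarith)
      nlinarith [ht i]
    have e4 := mul_le_mul_of_nonneg_left e3 hL
    rw [e1, mul_assoc 2 (((q : ℝ) - 1) / q), e2]
    nlinarith
  have h5 : ∑ i, (levelSum q r 0 - coeffL q r i) * t i =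
      levelSum q r 0 * ∑ i, t i - ∑ i, coeffL q r i * t i := by
    rw [mul_sum, ← sum_sub_distrib]
    exact sum_congr rfl fun i _ => by ring
  rw [h5]
  linarith

end Counting

/-! ### The two finite bounds -/

section Finite

lemma blockKernel_pos {Q : Type*} [AddCommGroup Q] {q r : ℕ} (hq : 0 < q) (hr : 1 ≤ r)
    (b : Fin r → Q) :
    0 < blockKernel q b :=
  levelSum_pos hq hr (blockWeight_le b)

lemma blockKernel_neg {Q : Type*} [AddCommGroup Q] {q r : ℕ} (b : Fin r → Q) :
    blockKernel q (-b) = blockKernel q b := by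
  simp only [blockKernel, blockWeight_neg]

lemma weight_zero {Q : Type*} [AddCommGroup Q] {n r : ℕ} :
    weight (0 : Fin n → Fin r → Q) = 0 := by
  simp [weight_eq_sum, blockWeight_zero]

lemma two_le_card_block {Q : Type*} [Fintype Q] {q r : ℕ} (hq : 2 ≤ q) (hr : 1 ≤ r)
    (hQ : Fintype.card Q = q) : 2 ≤ Fintype.card (Fin r → Q) := by
  rw [Fintype.card_fun, hQ, Fintype.card_fin]
  exact hq.trans (Nat.le_self_pow (by omega) q)

variable {Q₁ Q₂ : Type*} [AddCommGroup Q₁] [Fintype Q₁] [AddCommGroup Q₂] [Fintype Q₂]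

/-- The Fourier transform of the kernel on words is `n r - weight`. -/
lemma sum_wordKernel_mul (E : DualPairing Q₁ Q₂) {q r n : ℕ} (hq : 0 < q)
    (hQ : Fintype.card Q₂ = q) (x : Fin n → Fin r → Q₁) :
    (((n * r - weight x : ℝ)) : ℂ) =
      ∑ h : Fin n → Fin r → Q₂, ((piKernel n (blockKernel q) h : ℝ) : ℂ) *
        ((E.rev r).pi (Fin n)).toFun x h := by
  have h1 := sum_piKernel_smul n (blockKernel q)
    (fun h : Fin n → Fin r → Q₂ => ((E.rev r).pi (Fin n)).toFun x h)
  simp only [Complex.real_smul] at h1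
  rw [h1]
  have h2 : ∀ (i : Fin n) (b : Fin r → Q₂),
      ((E.rev r).pi (Fin n)).toFun x (Pi.single i b) = (E.rev r).toFun (x i) b := by
    intro i b
    change ∏ j, (E.rev r).toFun (x j) ((Pi.single i b : Fin n → Fin r → Q₂) j) = _
    rw [prod_eq_single i]
    · simp
    · intro j _ hj
      rw [Pi.single_eq_of_ne hj, (E.rev r).zero_right]
    · simp
  simp_rw [h2, sum_blockKernel_mul E hq hQ, sum_sub_distrib, weight_eq_sum]
  simp

/-- The size of a code is bounded by the size of the support of the test function. -/
theorem eventually_code_bound (E : DualPairing Q₁ Q₂) {q r : ℕ} (hq : 2 ≤ q) (hr : 1 ≤ r)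
    (hQ : Fintype.card Q₂ = q) {φ : (Fin r → Q₂) → ℝ} (hφ : ∀ b, 0 ≤ φ b)
    (hφ1 : ∑ b, φ b ^ 2 = 1) {τ : ℝ} (hφ0 : φ 0 ^ 2 = 1 - τ) (h0 : 0 < τ) (h1 : τ < 1) {η : ℝ}
    (hη : 0 < η) :
    ∃ n₀ : ℕ, ∀ n, n₀ ≤ n → ∀ (d : ℕ) (C : Finset (Fin n → Fin r → Q₁)), IsOrderedCode d C →
      n * r - d ≤ n * (blockForm (blockKernel q) φ - 2 * η) →
      n * η * C.card ≤ d * Real.exp (n * (Real.qaryEntropy (q ^ r) τ + η)) := by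
  have hq0 : 0 < q := by omega
  obtain ⟨n₀, hn₀⟩ := exists_spectral_function (k := blockKernel q) (two_le_card_block hq hr hQ)
    (fun b => (blockKernel_pos hq0 hr b).le) blockKernel_neg hφ hφ1 hφ0 h0 h1 hη
  rw [Fintype.card_fun, hQ, Fintype.card_fin] at hn₀
  refine ⟨n₀, fun n hn d C ⟨hC, hd⟩ hθ => ?_⟩
  obtain ⟨f, hf, hf1, hlam, hsupp⟩ := hn₀ n hn
  have hn0 : (0 : ℝ) ≤ n * η := by positivity
  have hb := ((E.rev r).pi (Fin n)).code_spectral_bound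
    (fun x => sum_wordKernel_mul E hq0 hQ x) hf hlam (θ := n * r - d) (by linarith) C hC
    (fun x hx y hy hxy => by
      have : (d : ℝ) ≤ (weight (x - y) : ℝ) := Nat.cast_le.2 (hd x hx y hy hxy)
      linarith)
  rw [hf1, mul_one, weight_zero] at hb
  push_cast at hb
  calc n * η * C.card ≤ (n * (blockForm (blockKernel q) φ - η) - (n * r - d)) * C.card := by
        gcongr; linarith
    _ ≤ d * (∑ h, f h) ^ 2 := by refine hb.trans (le_of_eq ?_); ring
    _ ≤ _ := by gcongr

/-- The size of a set with vanishing character sums up to weight `t` is at least the size of the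
whole space divided by the size of the support of the test function. -/
theorem eventually_design_bound (E : DualPairing Q₁ Q₂) {q r : ℕ} (hq : 2 ≤ q) (hr : 1 ≤ r)
    (hQ : Fintype.card Q₂ = q) {φ : (Fin r → Q₂) → ℝ} (hφ : ∀ b, 0 ≤ φ b)
    (hφ1 : ∑ b, φ b ^ 2 = 1) {τ : ℝ} (hφ0 : φ 0 ^ 2 = 1 - τ) (h0 : 0 < τ) (h1 : τ < 1) {η : ℝ}
    (hη : 0 < η) :
    ∃ n₀ : ℕ, ∀ n, n₀ ≤ n → ∀ (t : ℕ) (A : Finset (Fin n → Fin r → Q₂)), A.Nonempty →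
      (∀ x : Fin n → Fin r → Q₁, x ≠ 0 → weight x ≤ t →
        ∑ a ∈ A, ((E.rev r).pi (Fin n)).toFun x a = 0) →
      n * r - (t + 1) ≤ n * (blockForm (blockKernel q) φ - 2 * η) →
      n * η * Fintype.card (Fin n → Fin r → Q₁) ≤
        (t + 1) * Real.exp (n * (Real.qaryEntropy (q ^ r) τ + η)) * A.card := by
  have hq0 : 0 < q := by omega
  obtain ⟨n₀, hn₀⟩ := exists_spectral_function (k := blockKernel q) (two_le_card_block hq hr hQ)
    (fun b => (blockKernel_pos hq0 hr b).le) blockKernel_neg hφ hφ1 hφ0 h0 h1 hη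
  rw [Fintype.card_fun, hQ, Fintype.card_fin] at hn₀
  refine ⟨n₀, fun n hn t A hA hsum hθ => ?_⟩
  obtain ⟨f, hf, hf1, hlam, hsupp⟩ := hn₀ n hn
  have hn0 : (0 : ℝ) ≤ n * η := by positivity
  have hb := ((E.rev r).pi (Fin n)).design_spectral_bound
    (fun x => sum_wordKernel_mul E hq0 hQ x) hf hlam (θ := n * r - (t + 1)) (by linarith)
    A hA (fun x hx => by
      rcases Nat.lt_or_ge t (weight x) with h | h
      · left
        have : ((t + 1 : ℕ) : ℝ) ≤ (weight x : ℝ) := Nat.cast_le.2 h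
        push_cast at this
        linarith
      · exact Or.inr (hsum x hx h))
  rw [hf1, mul_one, weight_zero] at hb
  push_cast at hb
  calc n * η * (Fintype.card (Fin n → Fin r → Q₁) : ℝ) ≤
        (n * (blockForm (blockKernel q) φ - η) - (n * r - (t + 1))) *
          (Fintype.card (Fin n → Fin r → Q₁) : ℝ) := by
        gcongr; linarith
    _ ≤ (t + 1) * (∑ h, f h) ^ 2 * A.card := by refine hb.trans (le_of_eq ?_); ring
    _ ≤ _ := by gcongr

end Finite

/-! ### Character sums of ordered orthogonal arrays -/

section OOA

lemma exists_leftAdjusted_superset {n r : ℕ} {I₀ : Finset (Fin n × Fin r)}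
    (hI₀ : LeftAdjusted I₀) {t : ℕ} (h0 : I₀.card ≤ t) (ht : t ≤ n * r) :
    ∃ I, I₀ ⊆ I ∧ LeftAdjusted I ∧ I.card = t := by
  induction t, h0 using Nat.le_induction with
  | base => exact ⟨I₀, Subset.rfl, hI₀, rfl⟩
  | succ t h0 ih =>
    obtain ⟨I, hsub, hI, hcard⟩ := ih (by omega)
    have hne : (Iᶜ).Nonempty := by
      rw [← card_pos, card_compl, hcard]
      simp only [Fintype.card_prod, Fintype.card_fin]
      omega
    obtain ⟨p, hp, hmin⟩ := exists_min_image Iᶜ (fun p => p.2) hne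
    rw [mem_compl] at hp
    refine ⟨insert p I, hsub.trans (subset_insert _ _), fun i j k hij hkj => ?_, ?_⟩
    · rcases mem_insert.1 hij with h | h
      · by_contra hk
        rw [mem_insert, not_or] at hk
        have h2 := hmin (i, k) (mem_compl.2 hk.2)
        rw [← h] at h2
        exact hk.1 (h ▸ Prod.ext rfl (le_antisymm hkj h2))
      · exact mem_insert_of_mem (hI i j k h hkj)
    · rw [card_insert_of_notMem hp, hcard]

variable {Q : Type*} [AddCommGroup Q] [Fintype Q]

/-- The character sums of an array of strength `t` vanish at the nontrivial characters of ordered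
weight at most `t`: the support of such a character lies in a left-adjusted set of `t`
coordinates. -/
theorem IsOOA.sum_eq_zero {n r t : ℕ} {A : Finset (Fin n → Fin r → Q)} (hA : IsOOA t A)
    {χ : Fin n → Fin r → AddChar Q ℂ} (hχ : χ ≠ 0) (hw : weight χ ≤ t) :
    ∑ a ∈ A, ∏ i, ∏ l, χ i l (a i l) = 0 := by
  classical
  obtain ⟨-, ht, θ, hθ⟩ := hA
  set I₀ : Finset (Fin n × Fin r) := univ.filter fun p => (p.2 : ℕ) < blockWeight (χ p.1) with hI₀
  have hadj : LeftAdjusted I₀ := by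
    intro i j k hij hkj
    simp only [hI₀, mem_filter, mem_univ, true_and] at hij ⊢
    exact lt_of_le_of_lt hkj hij
  have hcard : I₀.card = weight χ := by
    rw [hI₀, card_filter, Fintype.sum_prod_type, weight_eq_sum]
    refine sum_congr rfl fun i _ => ?_
    rw [Fin.sum_univ_eq_sum_range (fun l => if l < blockWeight (χ i) then 1 else 0) r,
      ← card_filter, show (range r).filter (· < blockWeight (χ i)) = range (blockWeight (χ i)) by
        ext l
        have := blockWeight_le (χ i)
        simp only [mem_filter, mem_range]; omega, card_range]
  obtain ⟨I, hsub, hI, hIt⟩ := exists_leftAdjusted_superset hadj (hcard.le.trans hw) ht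
  have hout : ∀ p, p ∉ I → χ p.1 p.2 = 0 := by
    intro p hp
    refine (blockWeight_le_iff (χ p.1) _).1 le_rfl p.2 ?_
    by_contra h
    exact hp (hsub (mem_filter.2 ⟨mem_univ _, not_le.1 h⟩))
  have hprod : ∀ a : Fin n → Fin r → Q, ∏ i, ∏ l, χ i l (a i l) =
      ∏ p : {p // p ∈ I}, χ p.1.1 p.1.2 (a p.1.1 p.1.2) := by
    intro a
    rw [← Fintype.prod_prod_type' (f := fun i l => χ i l (a i l)),
      prod_coe_sort I (fun p => χ p.1 p.2 (a p.1 p.2))]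
    symm
    refine prod_subset (subset_univ _) fun p _ hp => ?_
    rw [hout p hp, AddChar.zero_apply]
  simp_rw [hprod]
  rw [← sum_fiberwise (s := A) (g := fun a (p : {p // p ∈ I}) => a p.1.1 p.1.2)]
  have hfib : ∀ c : {p // p ∈ I} → Q,
      ∑ a ∈ A with (fun p : {p // p ∈ I} => a p.1.1 p.1.2) = c,
        ∏ p : {p // p ∈ I}, χ p.1.1 p.1.2 (a p.1.1 p.1.2) =
      θ * ∏ p : {p // p ∈ I}, χ p.1.1 p.1.2 (c p) := by
    intro c
    rw [← hθ I hI hIt c, ← nsmul_eq_mul, ← sum_const]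
    refine sum_congr (by ext a; simp [funext_iff]) fun a ha => ?_
    exact prod_congr rfl fun p _ => by rw [(mem_filter.1 ha).2 p]
  simp_rw [hfib]
  rw [← mul_sum, ← Fintype.prod_sum (fun (p : {p // p ∈ I}) x => χ p.1.1 p.1.2 x)]
  obtain ⟨i, hi⟩ := Function.ne_iff.1 hχ
  obtain ⟨l, hl⟩ := Function.ne_iff.1 hi
  have hmem : (i, l) ∈ I := by
    by_contra h
    exact hl (hout (i, l) h)
  rw [prod_eq_zero (mem_univ (⟨(i, l), hmem⟩ : {p // p ∈ I}))
    (AddChar.sum_eq_zero_iff_ne_zero.2 hl),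
    mul_zero]

end OOA

/-! ### Rates -/

section Rates

/-- The rate function is Mathlib's entropy function over the alphabet of `q ^ r` blocks, in other
units. -/
lemma lpRate_eq {q r : ℕ} (hq : 2 ≤ q) (τ : ℝ) :
    lpRate q r τ = Real.qaryEntropy (q ^ r) τ / (r * Real.log q) := by
  have hq2 : (2 : ℝ) ≤ q := by exact_mod_cast hq
  have hlog : Real.log q ≠ 0 := (Real.log_pos (by linarith)).ne'
  have hq1 : (q : ℝ) - 1 ≠ 0 := by linarith
  rcases Nat.eq_zero_or_pos r with rfl | hr
  · simp [lpRate]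
  have hqr : ((q : ℝ) ^ r - 1) ≠ 0 := by
    have : (1 : ℝ) < (q : ℝ) ^ r := one_lt_pow₀ (by linarith) (by omega)
    linarith
  have hr0 : (r : ℝ) ≠ 0 := by positivity
  rcases eq_or_ne τ 0 with rfl | hτ
  · simp [lpRate, qEntropy]
  · unfold lpRate qEntropy Real.qaryEntropy Real.binEntropy Real.logb
    rw [Real.log_div hτ hq1, Real.log_div hqr hq1, Real.log_inv, Real.log_inv]
    push_cast
    field_simp
    ring

lemma lpRate_top {q r : ℕ} (hq : 2 ≤ q) (hr : 1 ≤ r) : lpRate q r (1 - ((q : ℝ) ^ r)⁻¹) = 1 := by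
  have hq2 : (2 : ℝ) ≤ q := by exact_mod_cast hq
  have hlog : Real.log q ≠ 0 := (Real.log_pos (by linarith)).ne'
  have hr0 : (r : ℝ) ≠ 0 := by positivity
  have hN : (1 : ℝ) < (q : ℝ) ^ r := one_lt_pow₀ (by linarith) (by omega)
  have hN0 : (q : ℝ) ^ r ≠ 0 := by positivity
  rw [lpRate_eq hq, div_eq_one_iff_eq (mul_ne_zero hr0 hlog), ← Real.log_pow]
  unfold Real.qaryEntropy Real.binEntropy
  rw [sub_sub_cancel, inv_inv, show 1 - ((q : ℝ) ^ r)⁻¹ = ((q : ℝ) ^ r - 1) / (q : ℝ) ^ r by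
    field_simp, inv_div, Real.log_div hN0 (by linarith)]
  push_cast
  field_simp
  ring

lemma lpRate_continuous {q r : ℕ} (hq : 2 ≤ q) : Continuous (lpRate q r) := by
  rw [show lpRate q r = fun τ => Real.qaryEntropy (q ^ r) τ / (r * Real.log q) from
    funext (lpRate_eq hq)]
  exact Real.qaryEntropy_continuous.div_const _

/-- An exponential bound on `M` turns into a bound on the rate. -/
lemma rate_le_of_exp_bound {q r : ℕ} (hq : 2 ≤ q) (hr : 1 ≤ r) {n : ℕ → ℕ} {D M : ℕ → ℝ}
    {δ R c η : ℝ} (hn : Filter.Tendsto n Filter.atTop Filter.atTop) (hM : ∀ i, 0 < M i)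
    (hD : Filter.Tendsto (fun i => D i / ((r : ℝ) * n i)) Filter.atTop (nhds δ))
    (hR : Filter.Tendsto (fun i => Real.logb q (M i) / ((r : ℝ) * n i)) Filter.atTop (nhds R))
    (hη : 0 < η) (hb : ∀ᶠ i in Filter.atTop, n i * η * M i ≤ D i * Real.exp (n i * c)) :
    R ≤ c / (r * Real.log q) := by
  have hr0 : (0 : ℝ) < r := by exact_mod_cast hr
  have hlog : 0 < Real.log q := Real.log_pos (by exact_mod_cast (by omega : 1 < q))
  set a := |δ| + 1 with ha
  have ha0 : 0 < a := by positivity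
  have hlim : Filter.Tendsto (fun i => (Real.log (a * r / η) / (n i : ℝ) + c) / (r * Real.log q))
      Filter.atTop (nhds ((0 + c) / (r * Real.log q))) := by
    refine Filter.Tendsto.div_const (Filter.Tendsto.add_const _ ?_) _
    exact Filter.Tendsto.div_atTop tendsto_const_nhds (tendsto_natCast_atTop_atTop.comp hn)
  rw [zero_add] at hlim
  refine le_of_tendsto_of_tendsto hR hlim ?_
  have hδa : δ < a := (le_abs_self δ).trans_lt (by linarith)
  filter_upwards [hb, hn.eventually_gt_atTop 0, hD.eventually_le_const hδa] with i hi hni hDi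
  have hni' : (0 : ℝ) < n i := by exact_mod_cast hni
  rw [div_le_iff₀ (by positivity)] at hDi
  have h1 : M i ≤ a * r / η * Real.exp (n i * c) := by
    have h2 : n i * η * M i ≤ n i * η * (a * r / η * Real.exp (n i * c)) := by
      refine hi.trans ?_
      calc D i * Real.exp (n i * c) ≤ a * (r * n i) * Real.exp (n i * c) := by gcongr
        _ = _ := by field_simp
    exact le_of_mul_le_mul_left h2 (by positivity)
  have h3 : Real.log (M i) ≤ Real.log (a * r / η) + n i * c := by
    refine (Real.log_le_log (hM i) h1).trans (le_of_eq ?_)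
    rw [Real.log_mul (by positivity) (Real.exp_pos _).ne', Real.log_exp]
  unfold Real.logb
  calc Real.log (M i) / Real.log q / (r * n i)
      ≤ (Real.log (a * r / η) + n i * c) / Real.log q / (r * n i) := by gcongr
    _ = _ := by field_simp

/-- Passage from the test functions on a block to the parametric bound. The hypothesis `hbound` is
applied to test functions whose quadratic form is strictly larger than `r (1 - δ)`: they are found
by moving from a maximizer of `Λ` towards the constant function, along which the form increases,
unless the maximizer is the constant function itself, where the claimed bound is `1`. -/
theorem le_lpRate_of_bound {P : Type*} [AddCommGroup P] [Fintype P] {q r : ℕ} (hq : 2 ≤ q)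
    (hr : 1 ≤ r) (hP : Fintype.card P = q) {τ : ℝ} (hτ : τ ∈ Set.Icc (0 : ℝ) 1) {R : ℝ}
    (hR1 : R ≤ 1)
    (hbound : ∀ (ψ : (Fin r → P) → ℝ) (σ η : ℝ), (∀ b, 0 ≤ ψ b) → ∑ b, ψ b ^ 2 = 1 →
      ψ 0 ^ 2 = 1 - σ → 0 < σ → σ < 1 → 0 < η →
      r - r * lpDelta q r τ < blockForm (blockKernel q) ψ - 2 * η →
      R ≤ (Real.qaryEntropy (q ^ r) σ + η) / (r * Real.log q)) :
    R ≤ lpRate q r τ := by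
  have hr0 : (0 : ℝ) < r := by exact_mod_cast hr
  have hlog : 0 < Real.log q := Real.log_pos (by exact_mod_cast (by omega : 1 < q))
  obtain ⟨⟨t, ⟨ht, hts⟩, hmax⟩, -⟩ := isGreatest_maxLam q r hr τ hτ.1
  obtain ⟨φ, hφ, hφ1, hφ0, hform⟩ := exists_blockForm_ge_Lam hP hq ht (hts.le.trans hτ.2)
  rw [hts] at hφ0
  rw [hmax, levelSum_zero_eq hr] at hform
  have hv : r - r * lpDelta q r τ ≤ blockForm (blockKernel q) φ := by
    refine le_trans (le_of_eq ?_) hform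
    unfold lpDelta
    field_simp
    ring
  have hk : ∀ b : Fin r → P, 0 < blockKernel q b := blockKernel_pos (by omega) hr
  have hksum : ∑ b : Fin r → P, blockKernel q b = r := sum_blockKernel (by omega) hP
  have hle := blockForm_le (fun b => (hk b).le) hφ1
  have hcard : (Fintype.card (Fin r → P) : ℝ) = (q : ℝ) ^ r := by
    rw [Fintype.card_fun, hP, Fintype.card_fin]; push_cast; rfl
  rcases hle.eq_or_lt with heq | hlt
  · have h1 := sq_eq_inv_card_of_blockForm_eq hk hφ1 heq
    rw [hφ0, hcard] at h1
    rw [show τ = 1 - ((q : ℝ) ^ r)⁻¹ by linarith, lpRate_top hq hr]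
    exact hR1
  · set N := (q : ℝ) ^ r with hN
    have hN1 : 1 < N := one_lt_pow₀ (by exact_mod_cast (by omega : 1 < q)) (by omega)
    have hNi : 0 < N⁻¹ := by positivity
    have hNi1 : N⁻¹ < 1 := inv_lt_one_of_one_lt₀ hN1
    have hs : ∀ s : ℝ, 0 < s → s < 1 → R ≤ lpRate q r ((1 - s) * τ + s * (1 - N⁻¹)) := by
      intro s hs0 hs1
      obtain ⟨ψ, hψ, hψ1, hψ0, hψform⟩ :=
        exists_interpolation (fun b => (hk b).le) hφ1 hs0.le hs1.le
      rw [hksum] at hψform hlt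
      rw [hφ0, hcard] at hψ0
      set σ := (1 - s) * τ + s * (1 - N⁻¹) with hσ
      have hσ0 : 0 < σ := by
        have h1 : 0 ≤ (1 - s) * τ := mul_nonneg (by linarith) hτ.1
        have h2 : 0 < s * (1 - N⁻¹) := mul_pos hs0 (by linarith)
        linarith
      have hσ1 : σ < 1 := by
        have h1 : 0 ≤ (1 - s) * (1 - τ) := mul_nonneg (by linarith) (by linarith [hτ.2])
        have h2 : 0 < s * N⁻¹ := mul_pos hs0 hNi
        nlinarith
      have hgap : r - r * lpDelta q r τ < blockForm (blockKernel q) ψ := by nlinarith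
      rw [lpRate_eq hq, le_div_iff₀ (by positivity)]
      refine le_of_forall_pos_le_add fun ε hε => ?_
      set η := min ε ((blockForm (blockKernel q) ψ - (r - r * lpDelta q r τ)) / 3) with hη
      have hη0 : 0 < η := lt_min hε (by linarith)
      have h1 := hbound ψ σ η hψ hψ1 (by rw [hψ0, hσ]; ring) hσ0 hσ1 hη0
        (by linarith [min_le_right ε ((blockForm (blockKernel q) ψ -
          (r - r * lpDelta q r τ)) / 3)])
      rw [le_div_iff₀ (by positivity)] at h1
      linarith [min_le_left ε ((blockForm (blockKernel q) ψ - (r - r * lpDelta q r τ)) / 3)]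
    have hcont : Continuous fun s : ℝ => lpRate q r ((1 - s) * τ + s * (1 - N⁻¹)) :=
      (lpRate_continuous hq).comp (by fun_prop)
    have hlim := (hcont.tendsto 0).mono_left (nhdsWithin_le_nhds (s := Set.Ioi (0 : ℝ)))
    simp only [sub_zero, one_mul, zero_mul, add_zero] at hlim
    refine ge_of_tendsto hlim ?_
    filter_upwards [Ioo_mem_nhdsGT (zero_lt_one (α := ℝ))] with s hs'
    exact hs s hs'.1 hs'.2

variable {Q : Type*} [AddCommGroup Q] [Fintype Q] {q r : ℕ}

theorem IsCodeFamily.le_lpRate (hQ : Fintype.card Q = q) (hq : 2 ≤ q) (hr : 1 ≤ r) {τ R : ℝ}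
    (hτ : τ ∈ Set.Icc (0 : ℝ) 1) (h : IsCodeFamily Q r (lpDelta q r τ) R) :
    R ≤ lpRate q r τ := by
  obtain ⟨n, d, C, hn, hC, hd, hR⟩ := h
  rw [hQ] at hR
  have hr0 : (0 : ℝ) < r := by exact_mod_cast hr
  have hq1 : (1 : ℝ) < q := by exact_mod_cast (by omega : 1 < q)
  have hpos : ∀ i, (0 : ℝ) < (C i).card := fun i => by exact_mod_cast (hC i).1.card_pos
  refine le_lpRate_of_bound (P := AddChar Q ℂ) hq hr (AddChar.card_eq.trans hQ) hτ ?_ ?_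
  · refine le_of_tendsto' hR fun i => div_le_one_of_le₀ ?_ (by positivity)
    rw [Real.logb_le_iff_le_rpow hq1 (hpos i), mul_comm, ← Nat.cast_mul, Real.rpow_natCast]
    have h1 : (C i).card ≤ q ^ (n i * r) := by
      refine (card_le_univ _).trans (le_of_eq ?_)
      rw [Fintype.card_fun, Fintype.card_fun, hQ, Fintype.card_fin, Fintype.card_fin, ← pow_mul,
        mul_comm]
    exact_mod_cast h1
  · intro ψ σ η hψ hψ1 hψ0 hσ0 hσ1 hη hgap
    obtain ⟨n₀, hn₀⟩ := eventually_code_bound (DualPairing.ofAddChar Q) hq hr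
      (AddChar.card_eq.trans hQ) hψ hψ1 hψ0 hσ0 hσ1 hη
    refine rate_le_of_exp_bound hq hr hn hpos hd hR hη ?_
    have hlim : Filter.Tendsto (fun i => (r : ℝ) - r * ((d i : ℝ) / (r * n i))) Filter.atTop
        (nhds (r - r * lpDelta q r τ)) := (hd.const_mul _).const_sub _
    filter_upwards [hn.eventually_ge_atTop n₀, hlim.eventually_le_const hgap,
      hn.eventually_gt_atTop 0] with i hi hgi hni
    refine hn₀ (n i) hi (d i) (C i) (hC i) ?_
    have hni' : (0 : ℝ) < n i := by exact_mod_cast hni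
    refine le_trans (le_of_eq ?_) (mul_le_mul_of_nonneg_left hgi hni'.le)
    field_simp

theorem IsOOAFamily.one_sub_le_lpRate (hQ : Fintype.card Q = q) (hq : 2 ≤ q) (hr : 1 ≤ r)
    {τ R : ℝ} (hτ : τ ∈ Set.Icc (0 : ℝ) 1) (h : IsOOAFamily Q r (lpDelta q r τ) R) :
    1 - R ≤ lpRate q r τ := by
  obtain ⟨n, t, A, hn, hA, ht, hR⟩ := h
  rw [hQ] at hR
  have hr0 : (0 : ℝ) < r := by exact_mod_cast hr
  have hq1 : (1 : ℝ) < q := by exact_mod_cast (by omega : 1 < q)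
  have hpos : ∀ i, (0 : ℝ) < (A i).card := fun i => by exact_mod_cast (hA i).1.card_pos
  refine le_lpRate_of_bound (P := Q) hq hr hQ hτ ?_ ?_
  · have : 0 ≤ R := ge_of_tendsto' hR fun i =>
      div_nonneg (Real.logb_nonneg hq1 (by exact_mod_cast (hA i).1.card_pos)) (by positivity)
    linarith
  · intro ψ σ η hψ hψ1 hψ0 hσ0 hσ1 hη hgap
    obtain ⟨n₀, hn₀⟩ := eventually_design_bound (DualPairing.ofAddChar Q).flip hq hr hQ
      hψ hψ1 hψ0 hσ0 hσ1 hη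
    have hninv : Filter.Tendsto (fun i => 1 / ((r : ℝ) * n i)) Filter.atTop (nhds 0) :=
      Filter.Tendsto.div_atTop tendsto_const_nhds
        ((tendsto_natCast_atTop_atTop.comp hn).const_mul_atTop hr0)
    have ht' : Filter.Tendsto (fun i => ((t i : ℝ) + 1) / ((r : ℝ) * n i)) Filter.atTop
        (nhds (lpDelta q r τ)) := by
      simpa [add_div] using ht.add hninv
    have hR' : Filter.Tendsto (fun i => Real.logb q ((q : ℝ) ^ (n i * r) / (A i).card) /
        ((r : ℝ) * n i)) Filter.atTop (nhds (1 - R)) := by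
      refine (hR.const_sub 1).congr' ?_
      filter_upwards [hn.eventually_gt_atTop 0] with i hni
      have hni' : (0 : ℝ) < n i := by exact_mod_cast hni
      rw [Real.logb_div (by positivity) (hpos i).ne', Real.logb_pow,
        Real.logb_self_eq_one hq1, sub_div]
      push_cast
      rw [mul_one, mul_comm (n i : ℝ), div_self (by positivity)]
    -- The lower bound for `|A|` is an upper bound for the size `q ^ (n r) / |A|` of a code-like
    -- object with distance `t + 1`.
    refine rate_le_of_exp_bound hq hr hn (fun i => div_pos (by positivity) (hpos i)) ht' hR' hη ?_
    have hlim : Filter.Tendsto (fun i => (r : ℝ) - r * (((t i : ℝ) + 1) / (r * n i)))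
        Filter.atTop (nhds (r - r * lpDelta q r τ)) := (ht'.const_mul _).const_sub _
    filter_upwards [hn.eventually_ge_atTop n₀, hlim.eventually_le_const hgap,
      hn.eventually_gt_atTop 0] with i hi hgi hni
    have hni' : (0 : ℝ) < n i := by exact_mod_cast hni
    -- The pairing matches position `l` of a character with position `r + 1 - l` of a word.
    let ρ : (Fin (n i) → Fin r → Q) ≃ (Fin (n i) → Fin r → Q) :=
      Equiv.arrowCongr (Equiv.refl _) (Equiv.arrowCongr Fin.revPerm (Equiv.refl Q))
    have hb := hn₀ (n i) hi (t i) ((A i).map ρ.toEmbedding) ((hA i).1.map) (fun x hx hw => ?_) ?_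
    · rw [card_map, Fintype.card_fun, Fintype.card_fun, AddChar.card_eq, hQ, Fintype.card_fin,
        Fintype.card_fin, ← pow_mul, mul_comm r] at hb
      push_cast at hb
      rw [← mul_div_assoc, div_le_iff₀ (hpos i)]
      exact hb
    · rw [sum_map, ← (hA i).sum_eq_zero hx hw]
      refine sum_congr rfl fun a _ => ?_
      change ∏ j, ∏ l, x j l (a j (Fin.rev (Fin.rev l))) = _
      simp_rw [Fin.rev_rev]
    · refine le_trans (le_of_eq ?_) (mul_le_mul_of_nonneg_left hgi hni'.le)
      field_simp

end Rates

end NRT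

theorem theorem5p4 (Q : Type*) [AddCommGroup Q] [Fintype Q] (q r : ℕ)
    (hQ : Fintype.card Q = q) (hq : 2 ≤ q) (hr : 1 ≤ r)
    (δ : ℝ) (hδ : ∃ τ ∈ Set.Icc (0 : ℝ) 1, NRT.lpDelta q r τ = δ) :
    (∀ R : ℝ, NRT.IsCodeFamily Q r δ R → R ≤ NRT.RLP q r δ) ∧
    (∀ R : ℝ, NRT.IsOOAFamily Q r δ R → 1 - NRT.RLP q r δ ≤ R) := by
  have hne : (NRT.lpRate q r '' {τ | τ ∈ Set.Icc (0 : ℝ) 1 ∧ NRT.lpDelta q r τ = δ}).Nonempty := by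
    obtain ⟨τ, hτ, h⟩ := hδ
    exact ⟨_, τ, ⟨hτ, h⟩, rfl⟩
  refine ⟨fun R hR => le_csInf hne ?_, fun R hR => ?_⟩
  · rintro _ ⟨τ, ⟨hτ, rfl⟩, rfl⟩
    exact hR.le_lpRate hQ hq hr hτ
  · have : 1 - R ≤ NRT.RLP q r δ := le_csInf hne <| by
      rintro _ ⟨τ, ⟨hτ, rfl⟩, rfl⟩
      exact hR.one_sub_le_lpRate hQ hq hr hτ
    linarith
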